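/- Let $F$ be a dyadic local field, i.e. a non-archimedean local field of characteristic $0$ whose residue field has characteristic $2$, with ring of integers $\mathfrak o$ and maximal ideal $(\pi)$. Let $(V,Q)$ be a non-degenerate quadratic space of dimension $3$ over $F$ with bilinear form $B(x,y)=\frac12\bigl(Q(x+y)-Q(x)-Q(y)\bigr)$, and let $L\subset V$ be an $\mathfrak o$-lattice of rank $3$ (a finitely generated $\mathfrak o$-submodule with $FL=V$). For an $\mathfrak o$-submodule $M\subseteq L$ let $\mathfrak s(M)$ and $\mathfrak n(M)$ be the $\mathfrak o$-submodules of $F$ generated by $\{B(x,y):x,y\in M\}$ and by $\{Q(x):x\in M\}$, respectively, and put $Q(M)=\{Q(x):x\in M\}$. For $\gamma,\alpha,\beta\in F$ with $\gamma\neq 0$, write $M\cong\gamma A(\alpha,\beta)$ if $M$ has an $\mathfrak o$-basis $x,y$ with $Q(x)=\gamma\alpha$, $B(x,y)=\gamma$, $Q(y)=\gamma\beta$. A lattice $M$ is modular if its Gram matrix with respect to $B$ in an $\mathfrak o$-basis is $a\,U$ with $a\in F^\times$ and $U$ an invertible matrix over $\mathfrak o$. A Jordan splitting of $L$ is an orthogonal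 decomposition $L=L_1\perp\cdots\perp L_t$ into nonzero modular lattices with $\mathfrak s(L_1)\supsetneq\cdots\supsetneq\mathfrak s(L_t)$. It is called a minimal norm Jordan splitting if for every Jordan splitting $L=L_1'\perp\cdots\perp L_t'$ and every $1\le i\le t$ one has $\mathfrak n(L_i)\subseteq\mathfrak n(L_i')$, and, for every $m\ge 0$, an orthogonal sum of $m$ copies of $\gamma_iA(0,0)$ is an orthogonal direct summand of $L_i$ (up to isometry) whenever it is one of $L_i'$, where $\mathfrak s(L_i)=\gamma_i\mathfrak o$. Suppose that $L=L_1\perp L_2$ is a minimal norm Jordan splitting. Then $L$ is universal, i.e. $Q(L)=\mathfrak o$, if and only if $\mathfrak n(L)=\mathfrak o$, $\operatorname{rank}(L_1)=2$, and at least one of the following conditions holds: 1. $L_1\cong 2^{-1}A(0,0)$; 2. $(\pi)\,\mathfrak n(L_1)=\mathfrak n(L_2)$ and $V=FL$ is isotropic; 3. $\mathfrak n(L_1)=(\pi)\,\mathfrak n(L_2)$ and $V=FL$ is isotropic. -/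

import Mathlib

open scoped ValuativeRel

namespace QuadLattice

section

variable {O K V : Type*} [CommRing O] [Field K] [Algebra O K]
  [AddCommGroup V] [Module K V] [Module O V] [IsScalarTower O K V]

/-- The symmetric bilinear form `B(x, y) = (Q(x + y) - Q(x) - Q(y)) / 2`, so that
`B(x, x) = Q(x)`. -/
def bil (Q : QuadraticForm K V) (x y : V) : K :=
  (Q (x + y) - Q x - Q y) / 2

/-- The scale `s(M)`: the `O`-submodule of `K` generated by all `B(x, y)` with `x, y ∈ M`. -/
def scale (Q : QuadraticForm K V) (M : Submodule O V) : Submodule O K :=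
  Submodule.span O {c | ∃ x ∈ M, ∃ y ∈ M, bil Q x y = c}

/-- The norm `n(M)`: the `O`-submodule of `K` generated by all `Q(x)` with `x ∈ M`. -/
def norm (Q : QuadraticForm K V) (M : Submodule O V) : Submodule O K :=
  Submodule.span O {c | ∃ x ∈ M, Q x = c}

/-- `M` and `N` are orthogonal to each other: `B(M, N) = 0`. -/
def Orth (Q : QuadraticForm K V) (M N : Submodule O V) : Prop :=
  ∀ x ∈ M, ∀ y ∈ N, bil Q x y = 0

/-- `M` is modular: it is free of finite rank, and in some basis (hence in every basis) its Gram
matrix is a nonzero scalar `a` times an invertible matrix over `O`. If the rank `r` is positive,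
this says that the scale of `M` is `aO` and the volume of `M` is `(aO) ^ r`. -/
def IsModular (Q : QuadraticForm K V) (M : Submodule O V) : Prop :=
  ∃ (a : K) (r : ℕ) (b : Module.Basis (Fin r) O M) (U : Matrix (Fin r) (Fin r) O),
    a ≠ 0 ∧ IsUnit U.det ∧
      ∀ i j, bil Q (b i : V) (b j : V) = a * algebraMap O K (U i j)

/-- `L = J 0 ⊥ J 1 ⊥ ⋯ ⊥ J (t - 1)` is a Jordan splitting: the components are nonzero, modular,
pairwise orthogonal, with strictly decreasing scales, and they add up to `L`. (The sum is
automatically direct, because modular lattices are nondegenerate.) -/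
structure IsJordanSplitting (Q : QuadraticForm K V) (L : Submodule O V) {t : ℕ}
    (J : Fin t → Submodule O V) : Prop where
  iSup_eq : ⨆ i, J i = L
  orth : ∀ i j, i ≠ j → Orth Q (J i) (J j)
  ne_bot : ∀ i, J i ≠ ⊥
  modular : ∀ i, IsModular Q (J i)
  scale_lt : ∀ i j, i < j → scale Q (J j) < scale Q (J i)

/-- `M ≅ γ A(α, β)`: `M` has a basis `x, y` with `Q(x) = γα`, `B(x, y) = γ`, `Q(y) = γβ`. -/
def IsBinary (Q : QuadraticForm K V) (γ α β : K) (M : Submodule O V) : Prop :=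
  ∃ x y : V, LinearIndependent O ![x, y] ∧ Submodule.span O {x, y} = M ∧
    Q x = γ * α ∧ bil Q x y = γ ∧ Q y = γ * β

/-- An orthogonal sum of `m` copies of `γ A(0, 0)` splits `M`, that is
`M = P 0 ⊥ ⋯ ⊥ P (m - 1) ⊥ N` with all `P i ≅ γ A(0, 0)`. (For `γ ≠ 0` the sum is automatically
direct, because the `P i` are nondegenerate.) -/
def HyperbolicSplits (Q : QuadraticForm K V) (γ : K) (m : ℕ) (M : Submodule O V) : Prop :=
  ∃ (P : Fin m → Submodule O V) (N : Submodule O V),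
    (∀ i, IsBinary Q γ 0 0 (P i)) ∧ (∀ i j, i ≠ j → Orth Q (P i) (P j)) ∧
      (∀ i, Orth Q (P i) N) ∧ (⨆ i, P i) ⊔ N = M

/-- A Jordan splitting `J` of `L` is a minimal norm Jordan splitting if for every Jordan splitting
`J'` of `L` with the same number of components and for every `i`, one has `n(J i) ⊆ n(J' i)`, and
an orthogonal sum of `m` copies of `γ A(0, 0)` splits `J i` whenever it splits `J' i`, where `γ` is
a generator of the scale of `J i`. (Different generators `γ` give isometric lattices
`γ A(0, 0)`.) -/
structure IsMinimalNormJordanSplitting (Q : QuadraticForm K V) (L : Submodule O V) {t : ℕ}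
    (J : Fin t → Submodule O V) : Prop extends IsJordanSplitting Q L J where
  norm_le : ∀ J' : Fin t → Submodule O V, IsJordanSplitting Q L J' →
    ∀ i, norm Q (J i) ≤ norm Q (J' i)
  hyperbolic : ∀ J' : Fin t → Submodule O V, IsJordanSplitting Q L J' →
    ∀ (i : Fin t) (γ : K) (m : ℕ), scale Q (J i) = Submodule.span O {γ} →
      HyperbolicSplits Q γ m (J' i) → HyperbolicSplits Q γ m (J i)

/-- `L` is universal: the set of values `Q(L)` is exactly the ring `O` (inside `K`). -/
def IsUniversal (Q : QuadraticForm K V) (L : Submodule O V) : Prop :=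
  {c : K | ∃ x ∈ L, Q x = c} = Set.range (algebraMap O K)

end

end QuadLattice

/-! When `n(L) = O` and `L₁` is binary, `L` carries the integral form `A x² + H x y + C y² + E z²`
(`ternary`), where `H = 2B(e₁, e₂)`. The element `h` with `H h = 2` is the inverse of `B(e₁, e₂)`,
so modularity of `L₁` says that `1 - h²AC` is a unit. Let `π` be a prime and `e` the order of `2`.

A universal lattice represents minus its discriminant, and this makes the ternary space isotropic
(`exists_isotropic`). So isotropy is available in both directions, except where `L₁ ≅ 2⁻¹A(0, 0)`
settles universality at once by `Q(x + t y) = t`. Given an isotropic vector `v`, one passes to a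
basis `e, v, f` with `f ⟂ v`. The values of `Q` then reduce to `Q(e) s² + Q(f) p²` plus a multiple
of `s`.

Sufficiency: if the norms of the components differ by exactly one factor `π`, then either a linear
equation along `v` solves the problem, or `Q(e)` and `Q(f)` have orders `0` and `1` in some order.
In the latter case squares in the perfect residue field match the digits of a target, one
coefficient serving the even orders and the other the odd ones. The term linear in `s` absorbs the
remaining error (`exists_repr`).

Necessity: the obstruction is the quadratic defect. The element `r² + 2r` never has odd order below
`2e`, and `1 + 4ρ - p²` always has even order at most `2e` for suitable `ρ`. Comparing parities of
orders excludes a unary `L₁` (`exists_not_represented_of_unit`). The same comparison, in its main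
case, excludes `π² ∣ E` with `H` a nonunit and `n(L₁) = O` (`exists_not_represented_of_sq_dvd`). If
`H` is a unit and `π² ∣ E`, Hensel's lemma makes `L₁` hyperbolic. Minimality of the splitting
matters only when both components have norm `O`: if `H` is a nonunit the norm of `L₁` could be
lowered (`IsBinaryFrame.not_isUnit_fst`), and otherwise a hyperbolic plane splits `L`, hence `L₁`
(`IsBinaryFrame.isBinary_of_minimal`). -/

set_option linter.unusedSectionVars false

namespace QuadLattice

/-! ### Squares modulo powers of `π`. -/

section DVR

variable {R : Type*} [CommRing R] [IsDomain R] [IsDiscreteValuationRing R] {π : R}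

theorem isUnit_iff_not_dvd (hπ : Irreducible π) {x : R} : IsUnit x ↔ ¬ π ∣ x := by
  rw [← Ideal.mem_span_singleton, ← hπ.maximalIdeal_eq, IsLocalRing.mem_maximalIdeal,
    mem_nonunits_iff, not_not]

theorem exists_eq_pow_mul (hπ : Irreducible π) {x : R} (hx : x ≠ 0) :
    ∃ (n : ℕ) (u : R), IsUnit u ∧ x = π ^ n * u := by
  obtain ⟨n, u, rfl⟩ := IsDiscreteValuationRing.eq_unit_mul_pow_irreducible hx hπ
  exact ⟨n, u, u.isUnit, mul_comm _ _⟩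

theorem isUnit_add_of_dvd (hπ : Irreducible π) {x y : R} (hx : IsUnit x) (hy : π ∣ y) :
    IsUnit (x + y) := by
  rw [isUnit_iff_not_dvd hπ] at *
  rwa [dvd_add_left hy]

/-- Elements with finite residue field of characteristic two have square roots modulo `π`. -/
theorem exists_dvd_sub_sq [Finite (IsLocalRing.ResidueField R)] (hπ : Irreducible π)
    (h2 : π ∣ 2) {a : R} (ha : IsUnit a) (f : R) : ∃ η, π ∣ f - a * η ^ 2 := by
  obtain ⟨b, hb⟩ := ha.exists_left_inv
  have h20 : (2 : IsLocalRing.ResidueField R) = 0 := by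
    have : IsLocalRing.residue R 2 = 0 := by
      rw [IsLocalRing.residue_eq_zero_iff, hπ.maximalIdeal_eq, Ideal.mem_span_singleton]
      exact h2
    rwa [map_ofNat] at this
  have : CharP (IsLocalRing.ResidueField R) 2 := CharTwo.of_one_ne_zero_of_two_eq_zero one_ne_zero h20
  have := Fintype.ofFinite (IsLocalRing.ResidueField R)
  obtain ⟨y, hy⟩ := (FiniteField.isSquare_of_char_two (ringChar.eq _ 2)
    (IsLocalRing.residue R (b * f)))
  obtain ⟨η, rfl⟩ := IsLocalRing.residue_surjective y
  refine ⟨η, ?_⟩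
  have : π ∣ b * f - η ^ 2 := by
    rw [← Ideal.mem_span_singleton, ← hπ.maximalIdeal_eq, ← IsLocalRing.residue_eq_zero_iff]
    rw [map_sub, hy, map_pow]; ring
  have e : f - a * η ^ 2 = a * (b * f - η ^ 2) := by linear_combination (-f) * hb
  rw [e]; exact this.mul_left _

/-- The map `x ↦ a x² + b x` is not surjective modulo `π`. -/
theorem exists_forall_not_dvd_sub [Finite (IsLocalRing.ResidueField R)] (hπ : Irreducible π)
    {a b : R} (ha : IsUnit a) (hb : IsUnit b) :
    ∃ u, ∀ x, ¬ π ∣ u - b * x - a * x ^ 2 := by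
  let k := IsLocalRing.ResidueField R
  let res := IsLocalRing.residue R
  let f : k → k := fun x => res b * x + res a * x ^ 2
  have ha' : res a ≠ 0 := (ha.map res).ne_zero
  have hb' : res b ≠ 0 := (hb.map res).ne_zero
  have hf : ¬ Function.Surjective f := by
    intro hs
    -- On a finite field surjectivity would give injectivity, but `f` agrees at `0` and at `-b/a`.
    have hi := Finite.injective_iff_surjective.2 hs
    have h0 : f 0 = f (-(res b / res a)) := by
      simp only [f]; field_simp; ring
    have := hi h0
    rw [eq_comm, neg_eq_zero, div_eq_zero_iff] at this
    tauto
  simp only [Function.Surjective, not_forall, not_exists] at hf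
  obtain ⟨y, hy⟩ := hf
  obtain ⟨u, rfl⟩ := IsLocalRing.residue_surjective y
  refine ⟨u, fun x hx => hy (res x) ?_⟩
  rw [← Ideal.mem_span_singleton, ← hπ.maximalIdeal_eq, ← IsLocalRing.residue_eq_zero_iff] at hx
  simp only [map_sub, map_mul, map_pow] at hx
  simp only [f, res]
  linear_combination -hx

theorem exists_add_two_mul (n : ℕ) {i j : ℕ} (hij : i + j = 1) :
    (∃ k, n = i + 2 * k) ∨ ∃ k, n = j + 2 * k := by
  rcases Nat.even_or_odd' n with ⟨k, rfl | rfl⟩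
  · rcases Nat.eq_zero_or_pos i with h | h
    · exact .inl ⟨k, by omega⟩
    · exact .inr ⟨k, by omega⟩
  · rcases Nat.eq_zero_or_pos i with h | h
    · exact .inr ⟨k, by omega⟩
    · exact .inl ⟨k, by omega⟩

theorem dvd_two {R : Type*} [CommRing R] {π ε : R} {e : ℕ} (he : (2 : R) = π ^ e * ε)
    (he1 : 1 ≤ e) : π ∣ 2 := by
  rw [he]; exact (dvd_pow_self π (by omega)).mul_right _

variable [Finite (IsLocalRing.ResidueField R)] {e : ℕ} {ε : R}

/-- Digits are matched one at a time. Since `i + j = 1`, each order has the parity of `i` or of `j`,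
and the corresponding square supplies any residue there. The cross term of the changed square
carries a factor `2`, hence does no harm up to `π ^ e`. -/
theorem exists_pow_dvd_sub (hπ : Irreducible π) (he : (2 : R) = π ^ e * ε) (he1 : 1 ≤ e)
    {i j : ℕ} (hij : i + j = 1) {a b : R} (ha : IsUnit a) (hb : IsUnit b) (g : R) :
    ∀ n ≤ e, ∃ s p, π ^ n ∣ g - (π ^ i * a * s ^ 2 + π ^ j * b * p ^ 2) := by
  intro n
  induction n with
  | zero => intro _; exact ⟨0, 0, by simp⟩
  | succ n ih =>
    intro hn
    obtain ⟨s, p, f, hf⟩ := ih (by omega)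
    have h2 : π ^ (n + 1) ∣ 2 := by rw [he]; exact (pow_dvd_pow π hn).mul_right _
    rcases exists_add_two_mul n hij with ⟨k, hk⟩ | ⟨k, hk⟩
    · obtain ⟨η, hη⟩ := exists_dvd_sub_sq hπ (dvd_two he he1) ha f
      refine ⟨s + π ^ k * η, p, ?_⟩
      have e1 : g - (π ^ i * a * (s + π ^ k * η) ^ 2 + π ^ j * b * p ^ 2) =
          π ^ n * (f - a * η ^ 2) - 2 * (π ^ i * a * s * π ^ k * η) := by
        have : π ^ n = π ^ i * (π ^ k) ^ 2 := by rw [hk, pow_add, pow_mul']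
        linear_combination hf + (a * η ^ 2) * this
      rw [e1, pow_succ]
      exact dvd_sub (mul_dvd_mul_left _ hη) ((pow_succ π n ▸ h2).mul_right _)
    · obtain ⟨η, hη⟩ := exists_dvd_sub_sq hπ (dvd_two he he1) hb f
      refine ⟨s, p + π ^ k * η, ?_⟩
      have e1 : g - (π ^ i * a * s ^ 2 + π ^ j * b * (p + π ^ k * η) ^ 2) =
          π ^ n * (f - b * η ^ 2) - 2 * (π ^ j * b * p * π ^ k * η) := by
        have : π ^ n = π ^ j * (π ^ k) ^ 2 := by rw [hk, pow_add, pow_mul']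
        linear_combination hf + (b * η ^ 2) * this
      rw [e1, pow_succ]
      exact dvd_sub (mul_dvd_mul_left _ hη) ((pow_succ π n ▸ h2).mul_right _)

/-- If one of `A`, `P` is a unit and the other one a prime, then every element is of the form
`A s² + P p² + 2 s r`. -/
theorem exists_repr (hπ : Irreducible π) (he : (2 : R) = π ^ e * ε) (hε : IsUnit ε)
    {i j : ℕ} (hij : i + j = 1) (hie : i + 1 ≤ e) {a b : R} (ha : IsUnit a) (hb : IsUnit b)
    (t : R) : ∃ s p r, π ^ i * a * s ^ 2 + π ^ j * b * p ^ 2 + 2 * s * r = t := by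
  have he1 : 1 ≤ e := by omega
  by_contra hcon
  -- Without a representation, the term `P p²` alone must approximate `t` modulo `4`. An error whose
  -- order has the parity of `j` is corrected through `p`; one whose order has the parity of `i`
  -- leads to a representation.
  have key : ∀ n ≤ 2 * e, ∃ p, π ^ n ∣ t - π ^ j * b * p ^ 2 := by
    intro n
    induction n with
    | zero => intro _; exact ⟨0, by simp⟩
    | succ n ih =>
      intro hn
      obtain ⟨p, f, hf⟩ := ih (by omega)
      rcases exists_add_two_mul n hij with ⟨k, hk⟩ | ⟨k, hk⟩
      · by_cases hfu : π ∣ f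
        · obtain ⟨f', rfl⟩ := hfu
          exact ⟨p, f', by rw [hf]; ring⟩
        exfalso; apply hcon
        -- With `n = i + 2k`, the error is `π ^ (2k)` times `π ^ i * f`. Its approximation modulo `π
        -- ^ e` has `δ` a unit because `f` is one and `i < e`. What is left is then a multiple of `2
        -- π ^ k`, and so of `2 s` for `s = π ^ k δ`.
        obtain ⟨δ, δ', h, hh⟩ := exists_pow_dvd_sub hπ he he1 hij ha hb (π ^ i * f) e le_rfl
        have hδ : IsUnit δ := by
          rw [isUnit_iff_not_dvd hπ]
          rintro ⟨d, rfl⟩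
          apply hfu
          obtain ⟨e', rfl⟩ : ∃ e', e = i + 1 + e' := ⟨e - (i + 1), by omega⟩
          rcases Nat.eq_zero_or_pos i with h0 | h0
          · obtain rfl : i = 0 := h0
            obtain rfl : j = 1 := by omega
            exact ⟨a * d ^ 2 * π + b * δ' ^ 2 + π ^ e' * h, by linear_combination hh⟩
          · obtain rfl : i = 1 := by omega
            obtain rfl : j = 0 := by omega
            have h1 : π ∣ b * δ' ^ 2 :=
              ⟨f - a * (π * d) ^ 2 - π * π ^ e' * h, by linear_combination (-1) * hh⟩
            have h2 : π ∣ δ' := by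
              rcases hπ.prime.dvd_or_dvd h1 with h | h
              · exact absurd h ((isUnit_iff_not_dvd hπ).1 hb)
              · exact hπ.prime.dvd_of_dvd_pow h
            obtain ⟨d', rfl⟩ := h2
            refine ⟨a * d ^ 2 * π + b * d' ^ 2 + π ^ e' * h, ?_⟩
            apply mul_left_cancel₀ hπ.ne_zero
            linear_combination hh
        obtain ⟨w, hw⟩ := hδ.exists_left_inv
        obtain ⟨v, hv⟩ := hε.exists_left_inv
        refine ⟨π ^ k * δ, p + π ^ k * δ', w * (- π ^ j * b * p * δ' + π ^ k * (v * h)), ?_⟩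
        have e1 : π ^ n = π ^ i * (π ^ k) ^ 2 := by rw [hk, pow_add, pow_mul']
        have e2 : π ^ e = 2 * v := by rw [he]; linear_combination (-π ^ e) * hv
        rw [e1] at hf
        rw [e2] at hh
        linear_combination (-1) * hf - (π ^ k) ^ 2 * hh +
          2 * π ^ k * (- π ^ j * b * p * δ' + π ^ k * (v * h)) * hw
      · obtain ⟨η, hη⟩ := exists_dvd_sub_sq hπ (dvd_two he he1) hb f
        refine ⟨p + π ^ k * η, ?_⟩
        have e0 : π ^ n = π ^ j * (π ^ k) ^ 2 := by rw [hk, pow_add, pow_mul']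
        have e1 : t - π ^ j * b * (p + π ^ k * η) ^ 2 =
          π ^ n * (f - b * η ^ 2) - π ^ e * (π ^ j * π ^ k) * (ε * b * p * η) := by
          rw [e0] at hf ⊢
          linear_combination hf - π ^ j * b * p * π ^ k * η * he
        rw [e1]
        apply dvd_sub
        · rw [pow_succ]; exact mul_dvd_mul_left _ hη
        · rw [← pow_add, ← pow_add]
          exact (pow_dvd_pow π (by omega)).mul_right _
  obtain ⟨p, f, hf⟩ := key _ le_rfl
  obtain ⟨v, hv⟩ := hε.exists_left_inv
  apply hcon
  -- Now `t - P p²` is a multiple of `4`, and for `s = 2` the other terms are `4 (A + r)`.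
  refine ⟨2, p, v ^ 2 * f - π ^ i * a, ?_⟩
  have e2 : π ^ e = 2 * v := by rw [he]; linear_combination (-π ^ e) * hv
  have e3 : π ^ (2 * e) = (2 * v) ^ 2 := by rw [← e2, ← pow_mul']
  rw [e3] at hf
  linear_combination (-1) * hf

end DVR

/-- The value at `(x, y, z)` of the orthogonal sum of `A x² + H x y + C y²` and `E z²`. -/
def ternary {R : Type*} [CommRing R] (A H C E x y z : R) : R :=
  A * x ^ 2 + H * x * y + C * y ^ 2 + E * z ^ 2

/-! ### Identities for ternary forms. -/

section Ring

variable {R : Type*} [CommRing R]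

theorem ternary_shift (A H C E τ x y z : R) :
    ternary A (H + 2 * A * τ) (C + H * τ + A * τ ^ 2) E x y z =
      ternary A H C E (x + τ * y) y z := by
  unfold ternary; ring

theorem ternary_swap (A H C E x y z : R) : ternary A H C E x y z = ternary C H A E y x z := by
  unfold ternary; ring

/-- A ternary form that represents minus its discriminant is isotropic. -/
theorem exists_isotropic [IsDomain R] [CharZero R] {A H C E : R} (hA : A ≠ 0)
    {x y z : R} (h : ternary A H C E x y z = -(4 * A * C - H ^ 2) * E) :
    ∃ x y z : R, ¬ (x = 0 ∧ y = 0 ∧ z = 0) ∧ ternary A H C E x y z = 0 := by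
  obtain ⟨D, hD⟩ : ∃ D, D = 4 * A * C - H ^ 2 := ⟨_, rfl⟩
  obtain ⟨X, hX⟩ : ∃ X, X = 2 * A * x + H * y := ⟨_, rfl⟩
  have h2A : (2 * A : R) ≠ 0 := mul_ne_zero two_ne_zero hA
  have h4A : (4 * A : R) ≠ 0 := by
    rw [show (4 * A : R) = 2 * (2 * A) by ring]; exact mul_ne_zero two_ne_zero h2A
  rw [← hD] at h
  by_cases hz : z ^ 2 + D = 0
  -- Here `-D` is the square `z²`, so the binary part is already isotropic.
  · refine ⟨z - H, 2 * A, 0, fun hh => h2A hh.2.1, ?_⟩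
    apply mul_left_cancel₀ h4A
    unfold ternary
    rw [hD] at hz
    linear_combination 4 * A ^ 2 * hz
  -- Four `A` times the binary part is the norm of `X + y√-D`. The hypothesis makes `-4AE` the
  -- quotient of the norms of `X + y√-D` and `z + √-D`. Multiplying the first by the conjugate of
  -- the second, and clearing `2A`, gives the isotropic vector.
  · refine ⟨(X * z + D * y) - H * (X - y * z), 2 * A * (X - y * z), 2 * A * (z ^ 2 + D),
      fun hh => mul_ne_zero h2A hz hh.2.2, ?_⟩
    apply mul_left_cancel₀ h4A
    have h1 : X ^ 2 + D * y ^ 2 = - 4 * A * E * (z ^ 2 + D) := by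
      unfold ternary at h
      rw [hX]
      linear_combination 4 * A * h + y ^ 2 * hD
    unfold ternary
    linear_combination 4 * A ^ 2 * (z ^ 2 + D) * h1 - 4 * A ^ 2 * (X - y * z) ^ 2 * hD

end Ring

/-! ### Universality of isotropic ternary forms. -/

section DVR

variable {R : Type*} [CommRing R] [IsDomain R] [IsDiscreteValuationRing R] {π : R}

theorem exists_primitive (hπ : Irreducible π) {A H C E x y z : R}
    (h0 : ¬ (x = 0 ∧ y = 0 ∧ z = 0)) (h : ternary A H C E x y z = 0) :
    ∃ x y z, ¬ (π ∣ x ∧ π ∣ y ∧ π ∣ z) ∧ ternary A H C E x y z = 0 := by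
  classical
  have aux : ∀ w : R, w ≠ 0 → ∃ n : ℕ, ¬ π ^ n ∣ w := by
    intro w hw
    obtain ⟨n, u, hu, rfl⟩ := exists_eq_pow_mul hπ hw
    refine ⟨n + 1, fun hd => (isUnit_iff_not_dvd hπ).1 hu ?_⟩
    rw [pow_succ] at hd
    exact (mul_dvd_mul_iff_left (pow_ne_zero n hπ.ne_zero)).1 hd
  have hex : ∃ n : ℕ, ¬ (π ^ n ∣ x ∧ π ^ n ∣ y ∧ π ^ n ∣ z) := by
    by_cases hx : x = 0
    · by_cases hy : y = 0
      · obtain ⟨n, hn⟩ := aux z (fun hz => h0 ⟨hx, hy, hz⟩)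
        exact ⟨n, fun hh => hn hh.2.2⟩
      · obtain ⟨n, hn⟩ := aux y hy
        exact ⟨n, fun hh => hn hh.2.1⟩
    · obtain ⟨n, hn⟩ := aux x hx
      exact ⟨n, fun hh => hn hh.1⟩
  have hmin := fun m => Nat.find_min hex (m := m)
  have hs := Nat.find_spec hex
  rcases hn : Nat.find hex with _ | n
  · rw [hn] at hs; simp at hs
  · rw [hn] at hs
    have := hmin n (by omega)
    rw [not_not] at this
    obtain ⟨⟨x, rfl⟩, ⟨y, rfl⟩, ⟨z, rfl⟩⟩ := this
    refine ⟨x, y, z, fun hh => hs ?_, ?_⟩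
    · rw [pow_succ]
      exact ⟨mul_dvd_mul_left _ hh.1, mul_dvd_mul_left _ hh.2.1, mul_dvd_mul_left _ hh.2.2⟩
    · apply mul_left_cancel₀ (pow_ne_zero 2 (pow_ne_zero n hπ.ne_zero))
      unfold ternary at h ⊢
      linear_combination h

/-- On a line `e₂ + r v` with `v` isotropic, `Q` is affine in `r`. Its slope `2B(e₂, v) = H x + 2 C
y` is a unit as soon as `H` and `x` are, because `2` is not. -/
theorem represents_of_isUnit (hπ : Irreducible π) (h2 : π ∣ 2) {A H C E x y z : R}
    (hH : IsUnit H) (h : ternary A H C E x y z = 0) (hxy : ¬ (π ∣ x ∧ π ∣ y)) (t : R) :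
    ∃ x y z, ternary A H C E x y z = t := by
  wlog hx : IsUnit x generalizing A C x y
  · obtain ⟨y', x', z', hh⟩ := this (A := C) (C := A) (x := y) (y := x)
      (by rw [← ternary_swap]; exact h) (by tauto)
      (by rw [isUnit_iff_not_dvd hπ] at hx ⊢; tauto)
    exact ⟨x', y', z', by rw [ternary_swap]; exact hh⟩
  obtain ⟨w, hw⟩ := (isUnit_add_of_dvd hπ (hH.mul hx) (y := 2 * (C * y))
    (h2.mul_right _)).exists_left_inv
  obtain ⟨r, hr⟩ : ∃ r, r = (t - C) * w := ⟨_, rfl⟩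
  refine ⟨r * x, 1 + r * y, r * z, ?_⟩
  unfold ternary at h ⊢
  linear_combination r ^ 2 * h + (t - C) * hw + (H * x + 2 * C * y) * hr

theorem dvd_sq_iff (hπ : Irreducible π) {u x : R} (hu : IsUnit u) : π ∣ u * x ^ 2 ↔ π ∣ x := by
  constructor
  · intro h
    rcases hπ.prime.dvd_or_dvd h with h | h
    · exact absurd h ((isUnit_iff_not_dvd hπ).1 hu)
    · exact hπ.prime.dvd_of_dvd_pow h
  · intro h
    exact (dvd_pow h two_ne_zero).mul_left _

variable [Finite (IsLocalRing.ResidueField R)] {e : ℕ} {ε : R}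

/-- The isotropic vector `v` satisfies `2B(e₁, v) = H (y + h A x)`, that is, `H` times a unit. In
the basis `e₁, v, e₃ - κ e₁` with the last vector orthogonal to `v`, a suitable coefficient of `v`
turns the value into the shape handled by `exists_repr`. -/
theorem represents_of_isotropic (hπ : Irreducible π) (he : (2 : R) = π ^ e * ε) (hε : IsUnit ε)
    {i j : ℕ} (hij : i + j = 1) (hie : i + 1 ≤ e) {a b H h C x y z : R} (ha : IsUnit a)
    (hb : IsUnit b) (hH : H * h = 2) (hiso : ternary (π ^ i * a) H C (π ^ j * b) x y z = 0)
    (hμ : IsUnit (y + h * (π ^ i * a) * x)) (t : R) :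
    ∃ x y z, ternary (π ^ i * a) H C (π ^ j * b) x y z = t := by
  obtain ⟨m, hm⟩ := hμ.exists_left_inv
  obtain ⟨κ, hκ⟩ : ∃ κ, κ = h * (π ^ j * b) * z * m := ⟨_, rfl⟩
  -- The value at `e₃ - κ e₁` still has order `j`: for `j = 1` the factor `κ` is divisible by `π`,
  -- and for `i = 1` the coefficient of `κ²` is.
  obtain ⟨b', hb', hP⟩ : ∃ b', IsUnit b' ∧ π ^ j * b' = π ^ j * b + π ^ i * a * κ ^ 2 := by
    rcases Nat.eq_zero_or_pos i with h0 | h0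
    · obtain rfl : i = 0 := h0
      obtain rfl : j = 1 := by omega
      exact ⟨b + π * (a * (h * b * z * m) ^ 2), isUnit_add_of_dvd hπ hb (dvd_mul_right _ _),
        by rw [hκ]; ring⟩
    · obtain rfl : i = 1 := by omega
      obtain rfl : j = 0 := by omega
      exact ⟨b + π * (a * κ ^ 2), isUnit_add_of_dvd hπ hb (dvd_mul_right _ _), by ring⟩
  -- The multiple `r` of `v` chosen next makes `H (y + h A x) r` equal to `2 (ρ + A κ p)`; the
  -- second summand cancels the cross term of `e₁` with `e₃ - κ e₁`.
  obtain ⟨s, p, ρ, hs⟩ := exists_repr hπ he hε hij hie ha hb' t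
  obtain ⟨r, hr⟩ : ∃ r, r = m * h * (ρ + π ^ i * a * κ * p) := ⟨_, rfl⟩
  refine ⟨s - κ * p + r * x, r * y, p + r * z, ?_⟩
  rw [hP] at hs
  generalize π ^ i * a = A at *
  generalize π ^ j * b = E at *
  have h1 : H * (y + h * A * x) * r = 2 * (ρ + A * κ * p) := by
    rw [hr]
    linear_combination (H * h * (ρ + A * κ * p)) * hm + (ρ + A * κ * p) * hH
  have h2 : κ * (H * y + 2 * A * x) = 2 * E * z := by
    rw [hκ]
    linear_combination (H * h * E * z) * hm + E * z * hH - (h * E * z * m * A * x) * hH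
  unfold ternary at *
  linear_combination hs + r ^ 2 * hiso + s * h1 - r * p * h2 - s * r * A * x * hH

/-- An isotropic form `⟨binary modular⟩ ⊥ ⟨prime⟩` of norm one is universal. -/
theorem represents_of_isotropic_of_prime (hπ : Irreducible π) (he : (2 : R) = π ^ e * ε)
    (hε : IsUnit ε) (he1 : 1 ≤ e) {A H h C b x y z : R} (hAH : IsUnit A ∨ IsUnit H)
    (hb : IsUnit b) (hH : H * h = 2) (hmod : IsUnit (1 - h ^ 2 * A * C)) (h0 : ¬ (x = 0 ∧ y = 0 ∧ z = 0))
    (hiso : ternary A H C (π * b) x y z = 0) (t : R) :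
    ∃ x y z, ternary A H C (π * b) x y z = t := by
  have h2 := dvd_two he he1
  by_cases hHu : IsUnit H
  · obtain ⟨x, y, z, hp, hiso⟩ := exists_primitive hπ h0 hiso
    refine represents_of_isUnit hπ h2 hHu hiso ?_ t
    rintro ⟨⟨x, rfl⟩, ⟨y, rfl⟩⟩
    refine hp ⟨dvd_mul_right _ _, dvd_mul_right _ _, (dvd_sq_iff hπ hb).1
      ⟨-(A * x ^ 2 + H * x * y + C * y ^ 2), mul_left_cancel₀ hπ.ne_zero ?_⟩⟩
    unfold ternary at hiso
    linear_combination hiso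
  have hA : IsUnit A := hAH.resolve_right hHu
  rw [isUnit_iff_not_dvd hπ, not_not] at hHu
  -- Replacing `e₂` by `e₂ + τ e₁` makes its value divisible by `π`. This multiplies `H` by `ν = 1 +
  -- h A τ`, whose square is congruent to the unit `1 - h²AC`.
  obtain ⟨τ, hτ⟩ := exists_dvd_sub_sq hπ h2 hA.neg C
  obtain ⟨C', hC'⟩ : ∃ C', C' = C + H * τ + A * τ ^ 2 := ⟨_, rfl⟩
  have hC : π ∣ C' := by
    rw [hC', show C + H * τ + A * τ ^ 2 = C - -A * τ ^ 2 + H * τ by ring]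
    exact dvd_add hτ (hHu.mul_right _)
  obtain ⟨ν, hν⟩ : ∃ ν, ν = 1 + h * A * τ := ⟨_, rfl⟩
  have hνu : IsUnit ν := by
    have : ν ^ 2 = 1 - h ^ 2 * A * C + C' * (h ^ 2 * A) := by
      rw [hν, hC']; linear_combination (- h * A * τ) * hH
    rw [← isUnit_pow_iff two_ne_zero, this]
    exact isUnit_add_of_dvd hπ hmod (hC.mul_right _)
  obtain ⟨n, hn⟩ := hνu.exists_left_inv
  have hH' : H + 2 * A * τ = H * ν := by rw [hν]; linear_combination (- A * τ) * hH
  have hsh := fun x y z => ternary_shift A H C (π * b) τ x y z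
  rw [hH', ← hC'] at hsh
  have hiso' : ternary A (H * ν) C' (π * b) (x - τ * y) y z = 0 := by
    rw [hsh, sub_add_cancel, hiso]
  have h0' : ¬ (x - τ * y = 0 ∧ y = 0 ∧ z = 0) := by
    rintro ⟨h1, rfl, rfl⟩
    exact h0 ⟨by simpa using h1, rfl, rfl⟩
  obtain ⟨x, y, z, hp, hiso'⟩ := exists_primitive hπ h0' hiso'
  obtain ⟨C1, rfl⟩ := hC
  obtain ⟨H1, rfl⟩ := hHu
  have hx : π ∣ x := (dvd_sq_iff hπ hA).1 ⟨-(H1 * ν * x * y + C1 * y ^ 2 + b * z ^ 2), by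
    unfold ternary at hiso'; linear_combination hiso'⟩
  have hy : IsUnit y := by
    rw [isUnit_iff_not_dvd hπ]
    rintro ⟨y, rfl⟩
    obtain ⟨x, rfl⟩ := hx
    refine hp ⟨dvd_mul_right _ _, dvd_mul_right _ _, (dvd_sq_iff hπ hb).1
      ⟨-(A * x ^ 2 + π * H1 * ν * x * y + π * C1 * y ^ 2), mul_left_cancel₀ hπ.ne_zero ?_⟩⟩
    unfold ternary at hiso'
    linear_combination hiso'
  have := represents_of_isotropic hπ he hε (i := 0) (j := 1) rfl he1 hA hb (H := π * H1 * ν)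
    (h := h * n) (C := π * C1) (x := x) (y := y) (z := z)
    (by linear_combination hH + (π * H1 * h) * hn) (by simpa using hiso')
    (isUnit_add_of_dvd hπ hy (hx.mul_left _)) t
  obtain ⟨x, y, z, hxyz⟩ := this
  exact ⟨x + τ * y, y, z, by rw [← hsh]; simpa using hxyz⟩

/-- An isotropic form `⟨binary modular of norm (π)⟩ ⊥ ⟨unit⟩` is universal. -/
theorem represents_of_isotropic_of_unit (hπ : Irreducible π) (he : (2 : R) = π ^ e * ε)
    (hε : IsUnit ε) {a h b c E x y z : R} (hE : IsUnit E)
    (hH : π * b * h = 2) (hh : π ∣ h) (hab : IsUnit a ∨ IsUnit b)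
    (h0 : ¬ (x = 0 ∧ y = 0 ∧ z = 0))
    (hiso : ternary (π * a) (π * b) (π * c) E x y z = 0) (t : R) :
    ∃ x y z, ternary (π * a) (π * b) (π * c) E x y z = t := by
  have h2 : π ∣ 2 := ⟨b * h, by linear_combination -hH⟩
  by_cases hbu : IsUnit b
  · clear hab
    have hiso₁ := exists_primitive hπ h0 hiso
    clear h0 hiso x y z
    obtain ⟨x, y, z, hp, hiso⟩ := hiso₁
    have hz : π ∣ z := (dvd_sq_iff hπ hE).1 ⟨-(a * x ^ 2 + b * x * y + c * y ^ 2), by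
      unfold ternary at hiso; linear_combination hiso⟩
    wlog hx : IsUnit x generalizing a c x y
    · have hxd : π ∣ x := by rwa [isUnit_iff_not_dvd hπ, not_not] at hx
      obtain ⟨x', y', z', h⟩ := this (a := c) (c := a) (x := y) (y := x) (by tauto)
        (by rw [← ternary_swap]; exact hiso) (by rw [isUnit_iff_not_dvd hπ]; tauto)
      exact ⟨y', x', z', by rw [ternary_swap]; exact h⟩
    -- Move along `e₂ + ζ e₃ + r v`. With `ζ` adjusting the residue, both the remaining difference
    -- and the slope in `r` are divisible by `π`. After division the slope is a unit, since `2` is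
    -- divisible by `π²`.
    obtain ⟨ζ, k, hk⟩ := exists_dvd_sub_sq hπ h2 hE t
    obtain ⟨h, rfl⟩ := hh
    have hu : IsUnit (b * x + π * (h * b * (π * (c * y) + E * z * ζ))) :=
      isUnit_add_of_dvd hπ (hbu.mul hx) (dvd_mul_right _ _)
    obtain ⟨w, hw⟩ := hu.exists_left_inv
    obtain ⟨r, hr⟩ : ∃ r, r = (k - c) * w := ⟨_, rfl⟩
    refine ⟨r * x, 1 + r * y, ζ + r * z, ?_⟩
    unfold ternary at hiso ⊢
    linear_combination r ^ 2 * hiso - hk + π * (k - c) * hw +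
      π * (b * x + π * (h * b * (π * (c * y) + E * z * ζ))) * hr -
      r * (π * c * y + E * z * ζ) * hH
  have ha : IsUnit a := by tauto
  rw [isUnit_iff_not_dvd hπ, not_not] at hbu
  obtain ⟨b, rfl⟩ := hbu
  obtain ⟨τ, hτ⟩ := exists_dvd_sub_sq hπ h2 ha.neg c
  obtain ⟨c', hc'⟩ : ∃ c', π * c' = c + π * b * τ + a * τ ^ 2 := by
    obtain ⟨k, hk⟩ := hτ
    exact ⟨k + b * τ, by linear_combination -hk⟩
  obtain ⟨ν, hν⟩ : ∃ ν, ν = 1 + h * (π * a) * τ := ⟨_, rfl⟩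
  have hνu : IsUnit ν := by
    rw [hν]; exact isUnit_add_of_dvd hπ isUnit_one ⟨h * a * τ, by ring⟩
  obtain ⟨n, hn⟩ := hνu.exists_left_inv
  have hH' : π * (π * b) + 2 * (π * a) * τ = π * (π * b) * ν := by
    rw [hν]; linear_combination (- π * a * τ) * hH
  have hsh := fun x y z => ternary_shift (π * a) (π * (π * b)) (π * c) E τ x y z
  rw [hH', show π * c + π * (π * b) * τ + π * a * τ ^ 2 = π * (π * c') by
    linear_combination (-π) * hc'] at hsh
  have hiso' : ternary (π * a) (π * (π * b) * ν) (π * (π * c')) E (x - τ * y) y z = 0 := by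
    rw [hsh, sub_add_cancel, hiso]
  have h0' : ¬ (x - τ * y = 0 ∧ y = 0 ∧ z = 0) := by
    rintro ⟨h1, rfl, rfl⟩
    exact h0 ⟨by simpa using h1, rfl, rfl⟩
  obtain ⟨x, y, z, hp, hiso'⟩ := exists_primitive hπ h0' hiso'
  have hz : π ∣ z := (dvd_sq_iff hπ hE).1
    ⟨-(a * x ^ 2 + π * b * ν * x * y + π * c' * y ^ 2), by
      unfold ternary at hiso'; linear_combination hiso'⟩
  have hx : π ∣ x := by
    obtain ⟨z, rfl⟩ := hz
    refine (dvd_sq_iff hπ ha).1 ⟨-(b * ν * x * y + c' * y ^ 2 + E * z ^ 2),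
      mul_left_cancel₀ hπ.ne_zero ?_⟩
    unfold ternary at hiso'; linear_combination hiso'
  have hy : IsUnit y := by
    rw [isUnit_iff_not_dvd hπ]; tauto
  -- The coefficient `H` is divisible by `π²` and `h` by `π`, while `H h = 2`.
  have he2 : 1 + 1 ≤ e := by
    by_contra hlt
    obtain ⟨h, rfl⟩ := hh
    rcases (by omega : e = 0 ∨ e = 1) with rfl | rfl
    · exact (isUnit_iff_not_dvd hπ).1 hε ⟨π * π * b * h, by linear_combination -hH - he⟩
    · refine (isUnit_iff_not_dvd hπ).1 hε ⟨π * b * h, mul_left_cancel₀ hπ.ne_zero ?_⟩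
      linear_combination -hH - he
  have := represents_of_isotropic hπ he hε (i := 1) (j := 0) rfl he2 ha hE
    (H := π * (π * b) * ν) (h := h * n) (C := π * (π * c')) (x := x) (y := y) (z := z)
    (by linear_combination hH + (π * (π * b) * h) * hn) (by simpa using hiso')
    (isUnit_add_of_dvd hπ hy (hx.mul_left _)) t
  obtain ⟨x, y, z, hxyz⟩ := this
  exact ⟨x + τ * y, y, z, by rw [← hsh]; simpa using hxyz⟩

end DVR

/-! ### Forms that miss a value. -/

section DVR

variable {R : Type*} [CommRing R] [IsDomain R] [IsDiscreteValuationRing R] {π : R}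

theorem le_of_pow_mul_eq (hπ : Irreducible π) {a b : ℕ} {u w : R} (hu : IsUnit u)
    (h : π ^ a * u = π ^ b * w) : b ≤ a := by
  by_contra hlt
  obtain ⟨d, rfl⟩ : ∃ d, b = a + (d + 1) := ⟨b - a - 1, by omega⟩
  refine (isUnit_iff_not_dvd hπ).1 hu ⟨π ^ d * w,
    mul_left_cancel₀ (pow_ne_zero a hπ.ne_zero) ?_⟩
  rw [h]; ring

theorem pow_dvd_or_eq (hπ : Irreducible π) (n : ℕ) (x : R) :
    π ^ n ∣ x ∨ ∃ k u, k < n ∧ IsUnit u ∧ x = π ^ k * u := by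
  by_cases hx : x = 0
  · exact .inl (hx ▸ dvd_zero _)
  obtain ⟨k, u, hu, rfl⟩ := exists_eq_pow_mul hπ hx
  rcases le_or_gt n k with h | h
  · exact .inl ((pow_dvd_pow π h).mul_right _)
  · exact .inr ⟨k, u, h, hu, rfl⟩

variable {e : ℕ} {ε : R}

/-- `r² + 2 r` cannot have odd order less than the order of `4`. -/
theorem sq_add_two_mul_ne (hπ : Irreducible π) (he : (2 : R) = π ^ e * ε) {j : ℕ} (hj : j < e)
    {u : R} (hu : IsUnit u) (r : R) : r ^ 2 + 2 * r ≠ π ^ (2 * j + 1) * u := by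
  intro h
  obtain ⟨d, rfl⟩ : ∃ d, e = j + 1 + d := ⟨e - (j + 1), by omega⟩
  rcases pow_dvd_or_eq hπ (j + 1) r with ⟨r, rfl⟩ | ⟨k, v, hk, hv, rfl⟩
  · have := le_of_pow_mul_eq hπ (b := 2 * j + 2) (w := r ^ 2 + π ^ d * ε * r) hu
      (by rw [← h, he]; ring)
    omega
  · obtain ⟨l, rfl⟩ : ∃ l, j = k + l := ⟨j - k, by omega⟩
    have := le_of_pow_mul_eq hπ (a := 2 * k) (u := v ^ 2 + π * (π ^ (l + d) * ε * v))
      (isUnit_add_of_dvd hπ (hv.pow 2) (dvd_mul_right _ _))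
      ((by rw [he]; ring : _ = _).trans h)
    omega

/-- If `1 + 4ρ` has quadratic defect `(4)`, then `1 + 4ρ - p²` has even order at most that
of `4`. -/
theorem exists_one_add_four_mul_sub_sq (hπ : Irreducible π) (he : (2 : R) = π ^ e * ε)
    (hε : IsUnit ε) {ρ : R} (hρ : ∀ x, ¬ π ∣ ρ - 1 * x - 1 * x ^ 2) (p : R) :
    ∃ k u, k ≤ e ∧ IsUnit u ∧ 1 + 4 * ρ - p ^ 2 = π ^ (2 * k) * u := by
  obtain ⟨q, rfl⟩ : ∃ q, p = 1 + q := ⟨p - 1, by ring⟩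
  obtain ⟨v, hv⟩ := hε.exists_left_inv
  rcases pow_dvd_or_eq hπ e q with ⟨q, rfl⟩ | ⟨k, u, hk, hu, rfl⟩
  -- Writing `p = 1 + 2x` with `x = v q`, the difference is `4 (ρ - x - x²)`, and `ρ` was chosen to
  -- make the second factor a unit.
  · refine ⟨e, ε ^ 2 * (ρ - 1 * (v * q) - 1 * (v * q) ^ 2), le_rfl, (hε.pow 2).mul
      ((isUnit_iff_not_dvd hπ).2 (hρ _)), ?_⟩
    rw [show (4 : R) = 2 ^ 2 by norm_num, he]
    linear_combination ((π ^ e) ^ 2 * ε * q + (π ^ e) ^ 2 * q ^ 2 * (v * ε + 1)) * hv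
      - (π ^ e) * q * he
  · obtain ⟨d, rfl⟩ : ∃ d, e = k + 1 + d := ⟨e - (k + 1), by omega⟩
    refine ⟨k, -u ^ 2 + π * (π ^ d * ε * (-u) + π ^ (2 * d + 1) * ε ^ 2 * ρ), by omega,
      isUnit_add_of_dvd hπ (hu.pow 2).neg (dvd_mul_right _ _), ?_⟩
    rw [show (4 : R) = 2 ^ 2 by norm_num, he]
    linear_combination - π ^ k * u * he

variable [Finite (IsLocalRing.ResidueField R)]

/-- A form `⟨unit⟩ ⊥ π⟨binary unimodular⟩` is not universal. -/
theorem exists_not_represented_of_unit (hπ : Irreducible π) (he : (2 : R) = π ^ e * ε)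
    (hε : IsUnit ε) (he1 : 1 ≤ e) {A b c l x y z : R} (hA : IsUnit A) (hb : IsUnit b)
    (hmod : IsUnit (b * c - l ^ 2)) (h0 : ¬ (x = 0 ∧ y = 0 ∧ z = 0))
    (hiso : ternary (π * b) (2 * π * l) (π * c) A x y z = 0) :
    ∃ t, ∀ x y z, ternary (π * b) (2 * π * l) (π * c) A x y z ≠ t := by
  have h2 := dvd_two he he1
  obtain ⟨τ, hτ⟩ := exists_dvd_sub_sq hπ h2 hb.neg c
  obtain ⟨c', hc'⟩ : ∃ c', π * c' = c + 2 * l * τ + b * τ ^ 2 := by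
    obtain ⟨k, hk⟩ := hτ
    obtain ⟨d, hd⟩ := h2
    exact ⟨k + d * l * τ, by linear_combination -hk - l * τ * hd⟩
  obtain ⟨l', hl'⟩ : ∃ l', l' = l + b * τ := ⟨_, rfl⟩
  have hl : IsUnit l' := by
    rw [← isUnit_pow_iff two_ne_zero, show l' ^ 2 = -(b * c - l ^ 2) + π * (b * c') by
      rw [hl']; linear_combination (-b) * hc']
    exact isUnit_add_of_dvd hπ hmod.neg (dvd_mul_right _ _)
  have hsh := fun x y z => ternary_shift (π * b) (2 * π * l) (π * c) A τ x y z
  rw [show 2 * π * l + 2 * (π * b) * τ = 2 * π * l' by rw [hl']; ring,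
    show π * c + 2 * π * l * τ + π * b * τ ^ 2 = π * (π * c') by
      linear_combination (-π) * hc'] at hsh
  have hiso' : ternary (π * b) (2 * π * l') (π * (π * c')) A (x - τ * y) y z = 0 := by
    rw [hsh, sub_add_cancel, hiso]
  have h0' : ¬ (x - τ * y = 0 ∧ y = 0 ∧ z = 0) := by
    rintro ⟨h1, rfl, rfl⟩
    exact h0 ⟨by simpa using h1, rfl, rfl⟩
  obtain ⟨x, y, z, hp, hiso'⟩ := exists_primitive hπ h0' hiso'
  have hz : π ∣ z := (dvd_sq_iff hπ hA).1 ⟨-(b * x ^ 2 + 2 * l' * x * y + π * c' * y ^ 2), by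
      unfold ternary at hiso'; linear_combination hiso'⟩
  obtain ⟨z, rfl⟩ := hz
  have hx : π ∣ x := by
    obtain ⟨d, hd⟩ := h2
    refine (dvd_sq_iff hπ hb).1 ⟨-(d * l' * x * y + c' * y ^ 2 + A * z ^ 2),
      mul_left_cancel₀ hπ.ne_zero ?_⟩
    unfold ternary at hiso'; linear_combination hiso' - π * l' * x * y * hd
  have hy : IsUnit y := by
    rw [isUnit_iff_not_dvd hπ]; exact fun hy => hp ⟨hx, hy, dvd_mul_right _ _⟩
  have hμ : IsUnit (l' * y + b * x) := isUnit_add_of_dvd hπ (hl.mul hy) (hx.mul_left _)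
  obtain ⟨m, hm⟩ := hμ.exists_left_inv
  obtain ⟨w, hw⟩ := hy.exists_left_inv
  -- With this `κ` the vector `e₃ - κ e₁` is orthogonal to the isotropic vector, and its value is
  -- the unit `A'` below.
  obtain ⟨κ, hκ⟩ : ∃ κ, κ = A * z * m := ⟨_, rfl⟩
  obtain ⟨ρ, hρ⟩ := exists_forall_not_dvd_sub hπ (isUnit_one (M := R)) isUnit_one
  obtain ⟨A', hA'⟩ : ∃ A', A' = A + π * (b * κ ^ 2) := ⟨_, rfl⟩
  have hA'u : IsUnit A' := hA' ▸ isUnit_add_of_dvd hπ hA (dvd_mul_right _ _)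
  -- The unit `1 + 4ρ` has quadratic defect `(4)`, so its difference from any square has even order
  -- at most `2e`.
  refine ⟨A' * (1 + 4 * ρ), fun X Y Z hXYZ => ?_⟩
  rw [← sub_add_cancel X (τ * Y), ← hsh] at hXYZ
  generalize X - τ * Y = X at hXYZ
  obtain ⟨r, hr⟩ : ∃ r, r = Y * w := ⟨_, rfl⟩
  obtain rfl : Y = r * y := by rw [hr]; linear_combination (-Y) * hw
  obtain ⟨p, rfl⟩ : ∃ p, Z = p + r * (π * z) := ⟨Z - r * (π * z), by ring⟩
  obtain ⟨s, rfl⟩ : ∃ s, X = s - κ * p + r * x := ⟨X - r * x + κ * p, by ring⟩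
  have h1 : (l' * y + b * x) * κ = A * z := by
    rw [hκ]; linear_combination (A * z) * hm
  obtain ⟨σ, hσ⟩ : ∃ σ, σ = (l' * y + b * x) * r - b * κ * p := ⟨_, rfl⟩
  have h2 : A' * (1 + 4 * ρ - p ^ 2) = π * s * (b * s + 2 * σ) := by
    unfold ternary at hXYZ hiso'
    rw [hσ]
    linear_combination (-1) * hXYZ + r ^ 2 * hiso' - p ^ 2 * hA' - 2 * π * r * p * h1
  obtain ⟨k, u, hk, hu, hku⟩ := exists_one_add_four_mul_sub_sq hπ he hε hρ p
  rw [hku] at h2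
  -- The left side of `h2` has even order at most `2e`. The right side has order at least `2e + 1`
  -- if `π ^ e ∣ s`, and otherwise odd order `2 ord(s) + 1`.
  rcases pow_dvd_or_eq hπ e s with ⟨s, rfl⟩ | ⟨n, v, hn, hv, rfl⟩
  · have := le_of_pow_mul_eq hπ (a := 2 * k) (b := 2 * e + 1) (hA'u.mul hu)
      (w := s * (b * s + ε * σ)) (by
        rw [he] at h2; linear_combination h2)
    omega
  · obtain ⟨d, rfl⟩ : ∃ d, e = n + 1 + d := ⟨e - (n + 1), by omega⟩
    have h3 : π ^ (2 * k) * (A' * u) = π ^ (2 * n + 1) *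
        (b * v ^ 2 + π * (π ^ d * ε * σ * v)) := by
      rw [he] at h2; linear_combination h2
    have hu' : IsUnit (b * v ^ 2 + π * (π ^ d * ε * σ * v)) :=
      isUnit_add_of_dvd hπ (hb.mul (hv.pow 2)) (dvd_mul_right _ _)
    have h4 := le_of_pow_mul_eq hπ (hA'u.mul hu) h3
    have h5 := le_of_pow_mul_eq hπ hu' h3.symm
    omega

/-- The binary part represents minus the coefficient of `z²`, but divisibility of `z` keeps the
isotropic vector `(1, 0, 1)` out of the lattice. The missed value is a represented one, `π ^ j b (1
+ π h²ab)`, times a unit `1 + π ^ (2n+1) θ`, where `n + 1` is the order of `H`. Representing it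
would force some `r² + 2r` to have odd order below `2e`. -/
theorem exists_not_represented_of_dvd (hπ : Irreducible π) (he : (2 : R) = π ^ e * ε)
    (hε : IsUnit ε) {i j : ℕ} (hij : i + j = 1) {a b H h : R}
    (ha : IsUnit a) (hb : IsUnit b) (hH : H * h = 2) (hHπ : π ∣ H) :
    ∃ t, ∀ p s z, π ∣ z → -(π ^ j * b) * p ^ 2 + H * p * s + π ^ i * a * s ^ 2 +
      π ^ j * b * z ^ 2 ≠ t := by
  have hH0 : H ≠ 0 := by
    rintro rfl
    have h20 : (2 : R) = 0 := by rw [← hH, zero_mul]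
    rw [he] at h20
    exact mul_ne_zero (pow_ne_zero _ hπ.ne_zero) hε.ne_zero h20
  obtain ⟨n, H0, hH0u, rfl⟩ := exists_eq_pow_mul hπ hH0
  obtain ⟨n, rfl⟩ : ∃ m, n = m + 1 := by
    rcases n with _ | n
    · exact absurd (by simpa using hHπ) ((isUnit_iff_not_dvd hπ).1 hH0u)
    · exact ⟨n, rfl⟩
  have hne : n + 1 ≤ e := le_of_pow_mul_eq hπ hε (b := n + 1) (w := H0 * h) (by
    rw [← he, ← hH]; ring)
  have h2 := dvd_two he (by omega)
  have habu := ha.mul hb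
  -- This `θ` stays a unit after subtracting any `H0 x + a b x²`; such an expression is what the
  -- coordinate `V` contributes below.
  obtain ⟨θ, hθ⟩ := exists_forall_not_dvd_sub hπ habu hH0u
  obtain ⟨δ, hδ⟩ : ∃ δ, δ = h ^ 2 * (a * b) := ⟨_, rfl⟩
  have hδu : IsUnit (1 + π * δ) := isUnit_add_of_dvd hπ isUnit_one (dvd_mul_right _ _)
  obtain ⟨m, hm⟩ := hδu.exists_left_inv
  refine ⟨π ^ j * b * (1 + π * δ) * (1 + π ^ (2 * n + 1) * θ), ?_⟩
  rintro p s _ ⟨z, rfl⟩ heq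
  have hs : ∃ s', s = π ^ j * b * s' := by
    obtain ⟨b', hb'⟩ := hb.exists_left_inv
    have : π ^ j ∣ s := by
      rcases Nat.eq_zero_or_pos j with h0 | h0
      · obtain rfl : j = 0 := h0
        simp
      · obtain rfl : j = 1 := by omega
        obtain rfl : i = 0 := by omega
        rw [pow_one]
        refine (dvd_sq_iff hπ ha).1 ⟨b * (1 + π * δ) * (1 + π ^ (2 * n + 1) * θ) + b * p ^ 2
          - π ^ n * H0 * p * s - π ^ 2 * b * z ^ 2, ?_⟩
        linear_combination heq
    obtain ⟨s', rfl⟩ := this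
    exact ⟨b' * s', by linear_combination (-π ^ j * s') * hb'⟩
  obtain ⟨s, rfl⟩ := hs
  have hπij : π ^ i * π ^ j = π := by rw [← pow_add, hij, pow_one]
  have heq' : - p ^ 2 + π ^ (n + 1) * H0 * p * s + π * (a * b) * s ^ 2 + (π * z) ^ 2 =
      (1 + π * δ) * (1 + π ^ (2 * n + 1) * θ) := by
    apply mul_left_cancel₀ (mul_ne_zero (pow_ne_zero j hπ.ne_zero) hb.ne_zero)
    linear_combination heq - (π ^ j * b) * a * b * s ^ 2 * hπij
  -- After scaling, `z = V = r = 0` is the vector `p = 1`, `s = h` with value `1 + πδ`. Thus `V` and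
  -- `r` measure the deviation from it, and `r² + 2r = (1 + r)² - 1` appears.
  obtain ⟨V, hV⟩ : ∃ V, V = h * (p - π * z) - s := ⟨_, rfl⟩
  obtain ⟨r, hr⟩ : ∃ r, r = p - 1 - π * z - π ^ (n + 1) * H0 * V := ⟨_, rfl⟩
  obtain rfl : p = r + 1 + π * z + π ^ (n + 1) * H0 * V := by rw [hr]; ring
  obtain rfl : s = h * (r + 1) + V := by
    linear_combination hV + V * hH
  clear hV hr heq
  have key : (1 + π * δ) * (r ^ 2 + π ^ (n + 1) * H0 * V * r + 2 * r + π ^ (n + 1) * H0 * V -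
      π ^ (2 * n + 1) * θ) + π * (a * b) * V ^ 2 = π * z * (π ^ (n + 1) * H0) * V := by
    linear_combination heq' - ((r + 1 + π * z + π ^ (n + 1) * H0 * V) * (r + 1)) * hH +
      π * (a * b) * h * V * (r + 1) * hH +
      π * ((r + 1) ^ 2 + π ^ (n + 1) * H0 * V * (r + 1)) * hδ
  have hrd : π ∣ r := by
    obtain ⟨d, hd⟩ := h2
    refine hπ.prime.dvd_of_dvd_pow (n := 2) ⟨- δ * (r ^ 2 + π ^ (n + 1) * H0 * V * r + 2 * r +
      π ^ (n + 1) * H0 * V - π ^ (2 * n + 1) * θ) - (π ^ n * H0 * V * r + d * r +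
      π ^ n * H0 * V - π ^ (2 * n) * θ) - (a * b) * V ^ 2 + z * (π ^ (n + 1) * H0) * V, ?_⟩
    linear_combination key - r * hd
  obtain ⟨w, hw⟩ : ∃ w, m * (π * z) - r = π * w := by
    obtain ⟨r, rfl⟩ := hrd
    exact ⟨m * z - r, by ring⟩
  have key2 : r ^ 2 + 2 * r = π ^ (2 * n + 1) * θ - π ^ (n + 1) * H0 * V -
      m * (π * (a * b)) * V ^ 2 + π ^ (n + 1) * H0 * V * (π * w) := by
    linear_combination m * key - (r ^ 2 + π ^ (n + 1) * H0 * V * r + 2 * r +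
      π ^ (n + 1) * H0 * V - π ^ (2 * n + 1) * θ) * hm + π ^ (n + 1) * H0 * V * hw
  -- If `π ^ n ∣ V`, the right side of `key2` has order `2n + 1` by the choice of `θ`. Otherwise the
  -- term in `V²` dominates and the order is `2 ord(V) + 1`. Both are odd and below `2e`.
  rcases pow_dvd_or_eq hπ n V with ⟨V, rfl⟩ | ⟨k, u, hk, hu, rfl⟩
  · refine sq_add_two_mul_ne hπ he (j := n) (by omega) (u := (θ - H0 * V - a * b * V ^ 2) +
      π * (δ * m * (a * b) * V ^ 2 + H0 * V * w))
      (isUnit_add_of_dvd hπ ((isUnit_iff_not_dvd hπ).2 (hθ V)) (dvd_mul_right _ _)) r ?_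
    linear_combination key2 - π * (a * b) * (π ^ n * V) ^ 2 * hm
  · obtain ⟨d, rfl⟩ : ∃ d, n = k + 1 + d := ⟨n - (k + 1), by omega⟩
    refine sq_add_two_mul_ne hπ he (j := k) (by omega) (u := - (m * (a * b) * u ^ 2) +
      π * (π ^ (2 * d + 1) * θ - π ^ d * H0 * u + π ^ d * H0 * u * (π * w)))
      (isUnit_add_of_dvd hπ (((IsUnit.of_mul_eq_one _ hm).mul habu).mul (hu.pow 2)).neg
        (dvd_mul_right _ _)) r ?_
    linear_combination key2

/-- If `π ∣ H` and `π² ∣ E`, then `A x² + H x y + C y² + E z²` is not universal. -/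
theorem exists_not_represented_of_sq_dvd (hπ : Irreducible π) (he : (2 : R) = π ^ e * ε)
    (hε : IsUnit ε) (he1 : 1 ≤ e) {A H h C E x y z : R} (hA : IsUnit A)
    (hH : H * h = 2) (hHπ : π ∣ H) (hmod : IsUnit (1 - h ^ 2 * A * C)) (hE : π ^ 2 ∣ E)
    (hE0 : E ≠ 0) (h0 : ¬ (x = 0 ∧ y = 0 ∧ z = 0)) (hiso : ternary A H C E x y z = 0) :
    ∃ t, ∀ x y z, ternary A H C E x y z ≠ t := by
  have h2 := dvd_two he he1
  obtain ⟨τ, hτ⟩ := exists_dvd_sub_sq hπ h2 hA.neg C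
  obtain ⟨C', hC'⟩ : ∃ C', π * C' = C + H * τ + A * τ ^ 2 := by
    obtain ⟨k, hk⟩ := hτ
    obtain ⟨d, hd⟩ := hHπ
    exact ⟨k + d * τ, by linear_combination -hk - τ * hd⟩
  obtain ⟨ν, hν⟩ : ∃ ν, ν = 1 + h * A * τ := ⟨_, rfl⟩
  have hνu : IsUnit ν := by
    have : ν ^ 2 = 1 - h ^ 2 * A * C + π * (C' * (h ^ 2 * A)) := by
      rw [hν]; linear_combination (- h * A * τ) * hH - (h ^ 2 * A) * hC'
    rw [← isUnit_pow_iff two_ne_zero, this]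
    exact isUnit_add_of_dvd hπ hmod (dvd_mul_right _ _)
  obtain ⟨n, hn⟩ := hνu.exists_left_inv
  have hH' : H + 2 * A * τ = H * ν := by rw [hν]; linear_combination (- A * τ) * hH
  have hsh := fun x y z => ternary_shift A H C E τ x y z
  rw [hH', ← hC'] at hsh
  have hiso' : ternary A (H * ν) (π * C') E (x - τ * y) y z = 0 := by
    rw [hsh, sub_add_cancel, hiso]
  have h0' : ¬ (x - τ * y = 0 ∧ y = 0 ∧ z = 0) := by
    rintro ⟨h1, rfl, rfl⟩
    exact h0 ⟨by simpa using h1, rfl, rfl⟩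
  have hHh : H * ν * (h * n) = 2 := by linear_combination hH + (H * h) * hn
  have hHπ' : π ∣ H * ν := hHπ.mul_right _
  suffices ∃ t, ∀ x y z, ternary A (H * ν) (π * C') E x y z ≠ t by
    obtain ⟨t, ht⟩ := this
    refine ⟨t, fun x y z hxyz => ht (x - τ * y) y z ?_⟩
    rw [hsh, sub_add_cancel, hxyz]
  generalize H * ν = H at *
  generalize h * n = h at *
  clear hsh hiso h0 hH hmod hC' hν hH'
  by_cases hC'u : π ∣ C'
  -- A value divisible by `π` needs `π ∣ x`, and then every term is divisible by `π²`.
  · refine ⟨π, fun x y z hxyz => ?_⟩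
    obtain ⟨H, rfl⟩ := hHπ'
    obtain ⟨E, rfl⟩ := hE
    obtain ⟨C, rfl⟩ := hC'u
    unfold ternary at hxyz
    obtain ⟨x, rfl⟩ : π ∣ x := (dvd_sq_iff hπ hA).1
      ⟨1 - H * x * y - π * C * y ^ 2 - π * E * z ^ 2, by linear_combination hxyz⟩
    apply hπ.not_isUnit
    refine .of_mul_eq_one (A * x ^ 2 + H * x * y + C * y ^ 2 + E * z ^ 2)
      (mul_left_cancel₀ hπ.ne_zero ?_)
    linear_combination hxyz
  rw [← isUnit_iff_not_dvd hπ] at hC'u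
  obtain ⟨N, b, hb, rfl⟩ := exists_eq_pow_mul hπ hE0
  have hN : 2 ≤ N := le_of_pow_mul_eq hπ hb (w := hE.choose) hE.choose_spec
  -- Dividing `e₃` by `π ^ k` enlarges the lattice until the unary coefficient has order `0` or `1`.
  -- The original lattice is where the new coordinate is divisible by `π ^ k`, and `k ≥ 1` because
  -- `N ≥ 2`.
  have hpr : ∀ j k, N = j + 2 * k → ∃ x y z, ¬ (π ∣ x ∧ π ∣ y ∧ π ∣ z) ∧
      ternary A H (π * C') (π ^ j * b) x y z = 0 := by
    rintro j k rfl
    refine exists_primitive hπ (x := x - τ * y) (y := y) (z := π ^ k * z) ?_ ?_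
    · simpa [hπ.ne_zero] using h0'
    · rw [← hiso']; unfold ternary; ring
  rcases exists_add_two_mul N (i := 0) (j := 1) rfl with ⟨k, hk⟩ | ⟨k, hk⟩
  · obtain ⟨x, y, z, hp, hiso⟩ := hpr _ _ hk
    obtain ⟨H1, rfl⟩ := hHπ'
    rw [pow_zero, one_mul] at hiso
    have hz : IsUnit z := by
      rw [isUnit_iff_not_dvd hπ]
      rintro ⟨z, rfl⟩
      obtain ⟨x, rfl⟩ : π ∣ x := (dvd_sq_iff hπ hA).1
        ⟨- (H1 * x * y + C' * y ^ 2 + π * b * z ^ 2), by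
          unfold ternary at hiso; linear_combination hiso⟩
      refine hp ⟨dvd_mul_right _ _, (dvd_sq_iff hπ hC'u).1
        ⟨- (A * x ^ 2 + H1 * x * y + b * z ^ 2), mul_left_cancel₀ hπ.ne_zero ?_⟩,
        dvd_mul_right _ _⟩
      unfold ternary at hiso; linear_combination hiso
    have hx : IsUnit x := by
      rw [isUnit_iff_not_dvd hπ]
      rintro ⟨x, rfl⟩
      refine (isUnit_iff_not_dvd hπ).1 hz ((dvd_sq_iff hπ hb).1
        ⟨- (A * π * x ^ 2 + π * H1 * x * y + C' * y ^ 2), ?_⟩)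
      unfold ternary at hiso; linear_combination hiso
    obtain ⟨w, hw⟩ := hz.exists_left_inv
    obtain ⟨x', hx'⟩ := hx.exists_left_inv
    -- The vector `(x e₁ + y e₂) / z` has value `-b`. Together with `e₂` it is a basis of the binary
    -- part, of the shape required by `exists_not_represented_of_dvd`; the middle coefficient is `H`
    -- times this unit.
    have hμ : IsUnit (w * x + π * (h * C' * (w * y))) := isUnit_add_of_dvd hπ
      ((IsUnit.of_mul_eq_one _ hw).mul hx) (dvd_mul_right _ _)
    obtain ⟨v, hv⟩ := hμ.exists_left_inv
    obtain ⟨t, ht⟩ := exists_not_represented_of_dvd hπ he hε (i := 1) (j := 0) rfl hC'u hb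
      (H := π * H1 * (w * x + π * (h * C' * (w * y)))) (h := h * v)
      (by linear_combination hHh + π * H1 * h * hv) ⟨_, mul_assoc _ _ _⟩
    refine ⟨t, fun X Y Z hXYZ => ht (X * x' * z) (Y - X * x' * y) (π ^ k * Z)
      ((dvd_pow_self π (by omega)).mul_right _) ?_⟩
    obtain ⟨X, rfl⟩ : ∃ X', X = X' * x := ⟨X * x', by linear_combination (-X) * hx'⟩
    obtain ⟨Y, rfl⟩ : ∃ Y', Y = Y' + X * y := ⟨Y - X * y, by ring⟩
    rw [show X * x * x' = X by linear_combination X * hx']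
    rw [hk] at hXYZ
    unfold ternary at hXYZ hiso
    linear_combination hXYZ - X ^ 2 * hiso + π * H1 * X * x * Y * hw +
      π * C' * X * y * Y * w * z * hHh + 2 * π * C' * X * y * Y * hw
  · obtain ⟨x, y, z, hp, hiso⟩ := hpr _ _ hk
    obtain ⟨H1, rfl⟩ := hHπ'
    rw [pow_one] at hiso
    have hx : π ∣ x := (dvd_sq_iff hπ hA).1 ⟨- (H1 * x * y + C' * y ^ 2 + b * z ^ 2), by
        unfold ternary at hiso; linear_combination hiso⟩
    have hz : IsUnit z := by
      rw [isUnit_iff_not_dvd hπ]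
      rintro ⟨z, rfl⟩
      obtain ⟨x, rfl⟩ := hx
      refine hp ⟨dvd_mul_right _ _, (dvd_sq_iff hπ hC'u).1
        ⟨- (A * x ^ 2 + H1 * x * y + π * b * z ^ 2), mul_left_cancel₀ hπ.ne_zero ?_⟩,
        dvd_mul_right _ _⟩
      unfold ternary at hiso; linear_combination hiso
    have hy : IsUnit y := by
      rw [isUnit_iff_not_dvd hπ]
      rintro ⟨y, rfl⟩
      obtain ⟨x, rfl⟩ := hx
      refine (isUnit_iff_not_dvd hπ).1 hz ((dvd_sq_iff hπ hb).1
        ⟨- (A * x ^ 2 + π * H1 * x * y + π * C' * y ^ 2), mul_left_cancel₀ hπ.ne_zero ?_⟩)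
      unfold ternary at hiso; linear_combination hiso
    obtain ⟨w, hw⟩ := hz.exists_left_inv
    obtain ⟨y', hy'⟩ := hy.exists_left_inv
    -- Here `(x e₁ + y e₂) / z` has value `-π b` and completes `e₁` to a basis of the binary part.
    have hμ : IsUnit (w * y + h * A * (w * x)) := isUnit_add_of_dvd hπ
      ((IsUnit.of_mul_eq_one _ hw).mul hy) ((hx.mul_left _).mul_left _)
    obtain ⟨v, hv⟩ := hμ.exists_left_inv
    obtain ⟨t, ht⟩ := exists_not_represented_of_dvd hπ he hε (i := 0) (j := 1) rfl hA hb
      (H := π * H1 * (w * y + h * A * (w * x))) (h := h * v)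
      (by linear_combination hHh + π * H1 * h * hv) ⟨_, mul_assoc _ _ _⟩
    refine ⟨t, fun X Y Z hXYZ => ht (Y * y' * z) (X - Y * y' * x) (π ^ k * Z)
      ((dvd_pow_self π (by omega)).mul_right _) ?_⟩
    obtain ⟨Y, rfl⟩ : ∃ Y', Y = Y' * y := ⟨Y * y', by linear_combination (-Y) * hy'⟩
    obtain ⟨X, rfl⟩ : ∃ X', X = X' + Y * x := ⟨X - Y * x, by ring⟩
    rw [show Y * y * y' = Y by linear_combination Y * hy']
    rw [hk] at hXYZ
    unfold ternary at hXYZ hiso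
    linear_combination hXYZ - Y ^ 2 * hiso + π * H1 * X * y * Y * hw +
      A * X * x * Y * w * z * hHh + 2 * A * X * x * Y * hw

omit [Finite (IsLocalRing.ResidueField R)] in
/-- Isotropic primitive vectors of a binary form with unit middle coefficient. -/
theorem exists_binary_isotropic [HenselianLocalRing R] (hπ : Irreducible π) (h2 : π ∣ 2)
    {A H C x y : R} (hH : IsUnit H)
    (hxy : ¬ (π ∣ x ∧ π ∣ y)) (h : π ∣ A * x ^ 2 + H * x * y + C * y ^ 2) :
    ∃ x y, ¬ (π ∣ x ∧ π ∣ y) ∧ A * x ^ 2 + H * x * y + C * y ^ 2 = 0 := by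
  wlog hx : IsUnit x generalizing A C x y
  · obtain ⟨y', x', h1, hh⟩ := this (A := C) (C := A) (x := y) (y := x) (by tauto)
      (by convert h using 1; ring) (by rw [isUnit_iff_not_dvd hπ] at hx ⊢; tauto)
    exact ⟨x', y', by tauto, by rw [← hh]; ring⟩
  obtain ⟨w, hw⟩ := hx.exists_left_inv
  -- Multiplying the form by `C` and setting `Y = C y / x` gives this monic polynomial. Its
  -- derivative at the approximate root is congruent to the unit `H`.
  open Polynomial in
  obtain ⟨Y, hY, -⟩ := HenselianLocalRing.is_henselian
    ((X : R[X]) ^ 2 + (Polynomial.C H * X + Polynomial.C (A * C))) (by monicity!) (C * y * w)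
    (by
      rw [hπ.maximalIdeal_eq, Ideal.mem_span_singleton]
      obtain ⟨k, hk⟩ := h
      refine ⟨w ^ 2 * C * k, ?_⟩
      simp
      linear_combination (w ^ 2 * C) * hk - A * C * (w * x + 1) * hw - C * H * y * w * hw)
    (by
      simp
      rw [add_comm, one_add_one_eq_two]
      exact isUnit_add_of_dvd hπ hH (h2.mul_right _))
  simp only [Polynomial.IsRoot, Polynomial.eval_add, Polynomial.eval_pow, Polynomial.eval_X,
    Polynomial.eval_mul, Polynomial.eval_C] at hY
  -- The two roots `Y` and `-H - Y` have unit sum, so one of them is a unit and gives a primitive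
  -- vector.
  by_cases hYu : π ∣ Y
  · refine ⟨C, -H - Y, fun hd => (isUnit_iff_not_dvd hπ).1 hH ?_, by linear_combination C * hY⟩
    rw [show H = -((-H - Y) + Y) by ring]
    exact (dvd_add hd.2 hYu).neg_right
  · exact ⟨C, Y, fun hd => hYu hd.2, by linear_combination C * hY⟩

end DVR

/-! ### The bilinear form, scales and rank-one lattices. -/

section Bilinear

variable {O K V : Type*} [CommRing O] [Field K] [Algebra O K]
  [AddCommGroup V] [Module K V] [Module O V] [IsScalarTower O K V] (Q : QuadraticForm K V)

theorem bil_eq_polarBilin (x y : V) : bil Q x y = Q.polarBilin x y / 2 := rfl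

theorem bil_comm (x y : V) : bil Q x y = bil Q y x := by
  unfold bil; rw [add_comm x y]; ring

theorem bil_add_left (x y z : V) : bil Q (x + y) z = bil Q x z + bil Q y z := by
  simp only [bil_eq_polarBilin, map_add, LinearMap.add_apply, add_div]

theorem bil_add_right (x y z : V) : bil Q x (y + z) = bil Q x y + bil Q x z := by
  simp only [bil_eq_polarBilin, map_add, add_div]

theorem bil_smul_left (c : O) (x y : V) :
    bil Q (c • x) y = algebraMap O K c * bil Q x y := by
  rw [algebra_compatible_smul K c x]
  simp only [bil_eq_polarBilin, map_smul, LinearMap.smul_apply, smul_eq_mul, mul_div_assoc]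

theorem bil_smul_right (c : O) (x y : V) :
    bil Q x (c • y) = algebraMap O K c * bil Q x y := by
  rw [bil_comm, bil_smul_left, bil_comm]

theorem map_smul_sq (c : O) (x : V) : Q (c • x) = algebraMap O K c ^ 2 * Q x := by
  rw [algebra_compatible_smul K c x, QuadraticMap.map_smul, smul_eq_mul, sq]

theorem bil_sum_left {n : ℕ} (c : Fin n → O) (v : Fin n → V) (y : V) :
    bil Q (∑ i, c i • v i) y = ∑ i, algebraMap O K (c i) * bil Q (v i) y := by
  have : ∀ s : Finset (Fin n),
      bil Q (∑ i ∈ s, c i • v i) y = ∑ i ∈ s, algebraMap O K (c i) * bil Q (v i) y := by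
    intro s
    induction s using Finset.cons_induction with
    | empty => simp [bil]
    | cons a s ha ih => rw [Finset.sum_cons, Finset.sum_cons, bil_add_left, ih, bil_smul_left]
  exact this _

theorem span_singleton_lt {F G : K}
    (h : Submodule.span O {F} < Submodule.span O {G}) :
    ∃ m : O, ¬ IsUnit m ∧ F = G * algebraMap O K m := by
  obtain ⟨m, hm⟩ := Submodule.mem_span_singleton.1 (h.le (Submodule.mem_span_singleton_self F))
  refine ⟨m, fun hu => h.not_ge ?_, by rw [← hm, Algebra.smul_def, mul_comm]⟩
  obtain ⟨n, hn⟩ := hu.exists_left_inv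
  rw [Submodule.span_singleton_le_iff_mem, Submodule.mem_span_singleton]
  exact ⟨n, by rw [← hm, smul_smul, hn, one_smul]⟩

theorem span_singleton_lt_of_eq [IsFractionRing O K] {F G : K} {m : O} (hG : G ≠ 0) (hm : ¬ IsUnit m)
    (h : F = G * algebraMap O K m) : Submodule.span O {F} < Submodule.span O {G} := by
  refine lt_of_le_not_ge ?_ fun hle => hm ?_
  · rw [Submodule.span_singleton_le_iff_mem, Submodule.mem_span_singleton]
    exact ⟨m, by rw [h, Algebra.smul_def, mul_comm]⟩
  · rw [Submodule.span_singleton_le_iff_mem, Submodule.mem_span_singleton] at hle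
    obtain ⟨n, hn⟩ := hle
    refine .of_mul_eq_one n (IsFractionRing.injective O K (mul_left_cancel₀ hG ?_))
    rw [map_mul, map_one]
    rw [h, Algebra.smul_def] at hn
    linear_combination hn

variable [CharZero K]

theorem bil_self (x : V) : bil Q x x = Q x := by
  unfold bil
  rw [← two_smul K x, QuadraticMap.map_smul, smul_eq_mul]
  field_simp; ring

theorem map_add_eq (x y : V) : Q (x + y) = Q x + Q y + 2 * bil Q x y := by
  unfold bil; field_simp; ring

variable {Q}

theorem scale_span_pair {x y : V} {G : K} {α β : O}
    (hx : Q x = G * algebraMap O K α) (hxy : bil Q x y = G) (hy : Q y = G * algebraMap O K β) :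
    scale Q (Submodule.span O {x, y}) = Submodule.span O {G} := by
  apply le_antisymm
  · unfold scale
    rw [Submodule.span_le]
    rintro c ⟨u, hu, v, hv, rfl⟩
    obtain ⟨p, q, rfl⟩ := Submodule.mem_span_pair.1 hu
    obtain ⟨r, s, rfl⟩ := Submodule.mem_span_pair.1 hv
    rw [SetLike.mem_coe, Submodule.mem_span_singleton]
    refine ⟨p * r * α + p * s + q * r + q * s * β, ?_⟩
    simp only [bil_add_left, bil_add_right, bil_smul_left, bil_smul_right, bil_self,
      bil_comm Q y x, hx, hy, hxy, Algebra.smul_def, map_add, map_mul]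
    ring
  · rw [Submodule.span_singleton_le_iff_mem]
    exact Submodule.subset_span ⟨x, Submodule.subset_span (.inl rfl), y,
      Submodule.subset_span (.inr rfl), hxy⟩

theorem scale_span_singleton (x : V) :
    scale Q (Submodule.span O {x}) = Submodule.span O {Q x} := by
  apply le_antisymm
  · unfold scale
    rw [Submodule.span_le]
    rintro c ⟨u, hu, v, hv, rfl⟩
    obtain ⟨p, rfl⟩ := Submodule.mem_span_singleton.1 hu
    obtain ⟨r, rfl⟩ := Submodule.mem_span_singleton.1 hv
    rw [SetLike.mem_coe, Submodule.mem_span_singleton]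
    refine ⟨p * r, ?_⟩
    simp only [bil_smul_left, bil_smul_right, bil_self, Algebra.smul_def, map_mul]
    ring
  · rw [Submodule.span_singleton_le_iff_mem]
    exact Submodule.subset_span ⟨x, Submodule.subset_span rfl, x,
      Submodule.subset_span rfl, bil_self Q x⟩

theorem isModular_span_singleton [IsFractionRing O K] {x : V} (hx : Q x ≠ 0) :
    IsModular Q (Submodule.span O {x}) := by
  have hx0 : x ≠ 0 := by rintro rfl; simp at hx
  have hli : LinearIndependent O ![x] := by
    rw [LinearIndependent.iff_fractionRing O K]
    exact LinearIndependent.of_subsingleton 0 hx0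
  have hspan : Submodule.span O (Set.range ![x]) = Submodule.span O {x} := by simp
  rw [← hspan]
  refine ⟨Q x, 1, Module.Basis.span hli, 1, hx, by simp, ?_⟩
  intro i j
  rw [Module.Basis.span_apply, Module.Basis.span_apply, Subsingleton.elim i 0,
    Subsingleton.elim j 0]
  simp [bil_self]

end Bilinear

/-! ### Modular lattices and the ranks of Jordan components. -/

section Modular

variable {O K V : Type*} [CommRing O] [IsDomain O] [Field K] [CharZero K] [Algebra O K]
  [IsFractionRing O K] [AddCommGroup V] [Module K V] [Module O V] [IsScalarTower O K V]
  {Q : QuadraticForm K V} {M : Submodule O V}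

/-- Modular lattices are nondegenerate. -/
theorem IsModular.eq_zero (hM : IsModular Q M) {x : V} (hx : x ∈ M)
    (h : ∀ y ∈ M, bil Q x y = 0) : x = 0 := by
  obtain ⟨a, r, b, U, ha, hU, hb⟩ := hM
  have hsum : x = ∑ i, b.repr ⟨x, hx⟩ i • (b i : V) := by
    have h1 := congrArg M.subtype (b.sum_repr ⟨x, hx⟩)
    rw [map_sum] at h1
    exact h1.symm
  have hc : b.repr ⟨x, hx⟩ = (0 : Fin r → O) := by
    apply Matrix.eq_zero_of_vecMul_eq_zero hU.ne_zero
    funext j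
    have h1 := h (b j) (b j).2
    rw [hsum, bil_sum_left] at h1
    simp only [hb] at h1
    apply IsFractionRing.injective O K
    simp only [Matrix.vecMul, dotProduct, Pi.zero_apply, map_zero, map_sum, map_mul]
    have h2 : a * ∑ i, algebraMap O K (b.repr ⟨x, hx⟩ i) * algebraMap O K (U i j) = 0 := by
      rw [Finset.mul_sum, ← h1]
      exact Finset.sum_congr rfl fun i _ => by ring
    exact (mul_eq_zero.1 h2).resolve_left ha
  rw [hsum]
  exact Finset.sum_eq_zero fun i _ => by rw [hc]; simp

theorem linearIndependent_pair_of_gram {x y : V} {G : K} {α β : O} (hG : G ≠ 0)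
    (hu : IsUnit (1 - α * β)) (hx : Q x = G * algebraMap O K α) (hxy : bil Q x y = G)
    (hy : Q y = G * algebraMap O K β) : LinearIndependent O ![x, y] := by
  rw [LinearIndependent.pair_iff]
  intro s t hst
  have h1 : bil Q (s • x + t • y) x = 0 := by rw [hst]; simp [bil]
  have h2 : bil Q (s • x + t • y) y = 0 := by rw [hst]; simp [bil]
  rw [bil_add_left, bil_smul_left, bil_smul_left, bil_self] at h1 h2
  rw [bil_comm Q y x, hxy, hx] at h1
  rw [hxy, hy] at h2
  have h1' : s * α + t = 0 := by
    apply IsFractionRing.injective O K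
    apply mul_left_cancel₀ hG
    simp only [map_add, map_mul, map_zero]; linear_combination h1
  have h2' : s + t * β = 0 := by
    apply IsFractionRing.injective O K
    apply mul_left_cancel₀ hG
    simp only [map_add, map_mul, map_zero]; linear_combination h2
  have hs : s = 0 := by
    refine (mul_eq_zero.1 (?_ : s * (1 - α * β) = 0)).resolve_right hu.ne_zero
    linear_combination h2' - β * h1'
  refine ⟨hs, ?_⟩
  rw [hs] at h1'; simpa using h1'

theorem isModular_span_pair {x y : V} {G : K} {α β : O} (hG : G ≠ 0)
    (hu : IsUnit (1 - α * β)) (hx : Q x = G * algebraMap O K α) (hxy : bil Q x y = G)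
    (hy : Q y = G * algebraMap O K β) : IsModular Q (Submodule.span O {x, y}) := by
  have hli := linearIndependent_pair_of_gram hG hu hx hxy hy
  have hspan : Submodule.span O (Set.range ![x, y]) = Submodule.span O {x, y} := by
    simp [Set.pair_comm]
  rw [← hspan]
  refine ⟨G, 2, Module.Basis.span hli, !![α, 1; 1, β], hG, ?_, ?_⟩
  · rw [Matrix.det_fin_two_of, show α * β - 1 * 1 = -(1 - α * β) by ring]
    exact hu.neg
  · intro i j
    rw [Module.Basis.span_apply, Module.Basis.span_apply]
    fin_cases i <;> fin_cases j
    · simpa [bil_self] using hx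
    · simpa using hxy
    · simpa [bil_comm Q y x] using hxy
    · simpa [bil_self] using hy

theorem span_range_coe_basis {O V : Type*} [CommRing O] [AddCommGroup V] [Module O V]
    {M : Submodule O V} {r : ℕ} (b : Module.Basis (Fin r) O M) :
    Submodule.span O (Set.range fun i => (b i : V)) = M := by
  have h := congrArg (Submodule.map M.subtype) b.span_eq
  rwa [Submodule.map_span, Submodule.map_top, Submodule.range_subtype, ← Set.range_comp] at h

/-- A binary modular lattice is of the form `G A(α, β)` with `1 - αβ` a unit. -/
theorem exists_isBinary_of_basis [IsLocalRing O] {a : K} (b : Module.Basis (Fin 2) O M)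
    {U : Matrix (Fin 2) (Fin 2) O} (ha : a ≠ 0) (hU : IsUnit U.det)
    (hb : ∀ i j, bil Q (b i : V) (b j : V) = a * algebraMap O K (U i j)) :
    ∃ (x y : V) (G : K) (α β : O), G ≠ 0 ∧ IsUnit (1 - α * β) ∧ Submodule.span O {x, y} = M ∧
      Q x = G * algebraMap O K α ∧ bil Q x y = G ∧ Q y = G * algebraMap O K β := by
  have hspan : Submodule.span O {(b 0 : V), (b 1 : V)} = M := by
    refine Eq.trans ?_ (span_range_coe_basis b)
    congr 1
    ext v
    simp [Fin.exists_fin_two, eq_comm]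
  have hsym : U 1 0 = U 0 1 := by
    apply IsFractionRing.injective O K
    apply mul_left_cancel₀ ha
    rw [← hb, ← hb, bil_comm]
  rw [Matrix.det_fin_two, hsym] at hU
  have h00 := hb 0 0
  have h01 := hb 0 1
  have h11 := hb 1 1
  rw [bil_self] at h00 h11
  have aux : ∀ u v w : O, IsUnit v → IsUnit (u * w - v * v) → ∀ n, n * v = 1 →
      IsUnit (1 - n * u * (n * w)) := by
    intro u v w hv hd n hn
    rw [show 1 - n * u * (n * w) = -(n ^ 2 * (u * w - v * v)) by
      linear_combination (-(n * v + 1)) * hn]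
    exact (((IsUnit.of_mul_eq_one _ hn).pow 2).mul hd).neg
  by_cases hu : IsUnit (U 0 1)
  · obtain ⟨n, hn⟩ := hu.exists_left_inv
    have hn' : algebraMap O K n * algebraMap O K (U 0 1) = 1 := by rw [← map_mul, hn, map_one]
    refine ⟨b 0, b 1, a * algebraMap O K (U 0 1), n * U 0 0, n * U 1 1,
      mul_ne_zero ha (hu.map _).ne_zero, aux _ _ _ hu hU n hn, hspan, ?_, h01, ?_⟩
    · rw [h00, map_mul]; linear_combination (-a * algebraMap O K (U 0 0)) * hn'
    · rw [h11, map_mul]; linear_combination (-a * algebraMap O K (U 1 1)) * hn'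
  -- If the off-diagonal entry is not a unit, the diagonal entries are, and replacing `y` by `x + y`
  -- makes the off-diagonal entry a unit.
  · have h0 : IsUnit (U 0 0) := by
      by_contra h
      have : ¬ IsUnit (U 0 0 * U 1 1 - U 0 1 * U 0 1) := by
        rw [← mem_nonunits_iff, ← IsLocalRing.mem_maximalIdeal] at *
        exact Ideal.sub_mem _ (Ideal.mul_mem_right _ _ h) (Ideal.mul_mem_right _ _ hu)
      exact this hU
    have hu' : IsUnit (U 0 0 + U 0 1) := by
      by_contra h
      refine (?_ : ¬ IsUnit (U 0 0)) h0
      rw [← mem_nonunits_iff, ← IsLocalRing.mem_maximalIdeal] at *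
      simpa using Ideal.sub_mem _ h hu
    obtain ⟨n, hn⟩ := hu'.exists_left_inv
    have hn' : algebraMap O K n * (algebraMap O K (U 0 0) + algebraMap O K (U 0 1)) = 1 := by
      rw [← map_add, ← map_mul, hn, map_one]
    refine ⟨b 0, b 0 + b 1, a * algebraMap O K (U 0 0 + U 0 1), n * U 0 0,
      n * (U 0 0 + 2 * U 0 1 + U 1 1),
      mul_ne_zero ha (hu'.map _).ne_zero, aux _ _ _ hu' ?_ n hn, ?_, ?_, ?_, ?_⟩
    · convert hU using 1; ring
    · refine Eq.trans ?_ hspan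
      apply le_antisymm
      · rw [Submodule.span_le]
        rintro v (rfl | rfl)
        · exact Submodule.subset_span (.inl rfl)
        · exact Submodule.add_mem _ (Submodule.subset_span (.inl rfl))
            (Submodule.subset_span (.inr rfl))
      · rw [Submodule.span_le]
        rintro v (rfl | rfl)
        · exact Submodule.subset_span (.inl rfl)
        · rw [SetLike.mem_coe, Submodule.mem_span_pair]
          exact ⟨-1, 1, by simp⟩
    · rw [h00, map_mul, map_add]
      linear_combination (-a * algebraMap O K (U 0 0)) * hn'
    · rw [bil_add_right, bil_self, h00, h01, map_add]; ring
    · rw [map_add_eq, h00, h01, h11]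
      simp only [map_mul, map_add, map_ofNat]
      linear_combination (-a * (algebraMap O K (U 0 0) + 2 * algebraMap O K (U 0 1) +
        algebraMap O K (U 1 1))) * hn'

theorem IsJordanSplitting.sup_eq {L L₁ L₂ : Submodule O V}
    (hJ : IsJordanSplitting Q L ![L₁, L₂]) : L₁ ⊔ L₂ = L := by
  rw [← hJ.iSup_eq]
  apply le_antisymm
  · exact sup_le (le_iSup ![L₁, L₂] 0) (le_iSup ![L₁, L₂] 1)
  · exact iSup_le (Fin.forall_fin_two.2 ⟨le_sup_left, le_sup_right⟩)

/-- The two components of a Jordan splitting of a lattice of rank three have ranks `2` and `1`. -/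
theorem IsJordanSplitting.cases {L L₁ L₂ : Submodule O V} [IsLocalRing O]
    (hV : Module.finrank K V = 3) (hL : L.IsLattice K)
    (hJ : IsJordanSplitting Q L ![L₁, L₂]) :
    (Module.finrank O L₁ = 2 ∧ ∃ (x y z : V) (G : K) (α β : O), G ≠ 0 ∧ IsUnit (1 - α * β) ∧
      Submodule.span O {x, y} = L₁ ∧ Q x = G * algebraMap O K α ∧ bil Q x y = G ∧
      Q y = G * algebraMap O K β ∧ Submodule.span O {z} = L₂ ∧ Q z ≠ 0) ∨
    (Module.finrank O L₁ = 1 ∧ ∃ (x y z : V) (G : K) (α β : O), G ≠ 0 ∧ IsUnit (1 - α * β) ∧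
      Submodule.span O {x, y} = L₂ ∧ Q x = G * algebraMap O K α ∧ bil Q x y = G ∧
      Q y = G * algebraMap O K β ∧ Submodule.span O {z} = L₁ ∧ Q z ≠ 0) := by
  have hm1 : IsModular Q L₁ := hJ.modular 0
  have hm2 : IsModular Q L₂ := hJ.modular 1
  have horth : Orth Q L₁ L₂ := hJ.orth 0 1 (by decide)
  have hb1 : L₁ ≠ ⊥ := hJ.ne_bot 0
  have hb2 : L₂ ≠ ⊥ := hJ.ne_bot 1
  have hsup := hJ.sup_eq
  have hm1' := hm1
  obtain ⟨a₁, r₁, b₁, U₁, ha₁, hU₁, hg₁⟩ := hm1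
  obtain ⟨a₂, r₂, b₂, U₂, ha₂, hU₂, hg₂⟩ := hm2
  have hli : ∀ {M : Submodule O V} {r : ℕ} (b : Module.Basis (Fin r) O M),
      LinearIndependent O (fun i => (b i : V)) := by
    intro M r b
    exact b.linearIndependent.map' M.subtype (Submodule.ker_subtype M)
  have hdis : Disjoint L₁ L₂ := by
    rw [Submodule.disjoint_def]
    intro x h1 h2
    exact hm1'.eq_zero h1 fun y hy => by rw [bil_comm]; exact horth y hy x h2
  have hind : LinearIndependent O (Sum.elim (fun i => (b₁ i : V)) (fun i => (b₂ i : V))) :=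
    (hli b₁).sum_type (hli b₂) (by
      rwa [span_range_coe_basis, span_range_coe_basis])
  rw [LinearIndependent.iff_fractionRing O K] at hind
  have htop : ⊤ ≤ Submodule.span K
      (Set.range (Sum.elim (fun i => (b₁ i : V)) (fun i => (b₂ i : V)))) := by
    have h : L ≤ Submodule.span O
        (Set.range (Sum.elim (fun i => (b₁ i : V)) (fun i => (b₂ i : V)))) := by
      rw [Set.Sum.elim_range, Submodule.span_union, span_range_coe_basis, span_range_coe_basis,
        hsup]
    rw [← hL.span_eq_top, Submodule.span_le]
    exact fun v hv => Submodule.span_subset_span O K _ (h hv)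
  have hcard := Module.finrank_eq_card_basis (Module.Basis.mk hind htop)
  rw [hV, Fintype.card_sum, Fintype.card_fin, Fintype.card_fin] at hcard
  have hpos : ∀ {M : Submodule O V} {r : ℕ} (b : Module.Basis (Fin r) O M), M ≠ ⊥ → r ≠ 0 := by
    rintro M r b hM rfl
    apply hM
    rw [← span_range_coe_basis b]; simp
  have h1 := hpos b₁ hb1
  have h2 := hpos b₂ hb2
  have hone : ∀ {M : Submodule O V} {a : K} (b : Module.Basis (Fin 1) O M)
      {U : Matrix (Fin 1) (Fin 1) O}, a ≠ 0 → IsUnit U.det →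
      (∀ i j, bil Q (b i : V) (b j : V) = a * algebraMap O K (U i j)) → Q (b 0 : V) ≠ 0 := by
    intro M a b U ha hU hg
    rw [← bil_self, hg]
    rw [Matrix.det_fin_one] at hU
    exact mul_ne_zero ha (hU.map _).ne_zero
  have hsp : ∀ {M : Submodule O V} (b : Module.Basis (Fin 1) O M),
      Submodule.span O {(b 0 : V)} = M := by
    intro M b
    refine Eq.trans ?_ (span_range_coe_basis b)
    congr 1
    ext v
    simp [eq_comm]
  rcases (by omega : r₁ = 2 ∧ r₂ = 1 ∨ r₁ = 1 ∧ r₂ = 2) with ⟨rfl, rfl⟩ | ⟨rfl, rfl⟩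
  · left
    obtain ⟨x, y, G, α, β, h1, h2, h3, h4, h5, h6⟩ := exists_isBinary_of_basis b₁ ha₁ hU₁ hg₁
    exact ⟨by simpa using Module.finrank_eq_card_basis b₁, x, y, b₂ 0, G, α, β, h1, h2, h3, h4,
      h5, h6, hsp b₂, hone b₂ ha₂ hU₂ hg₂⟩
  · right
    obtain ⟨x, y, G, α, β, h1, h2, h3, h4, h5, h6⟩ := exists_isBinary_of_basis b₂ ha₂ hU₂ hg₂
    exact ⟨by simpa using Module.finrank_eq_card_basis b₁, x, y, b₁ 0, G, α, β, h1, h2, h3, h4,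
      h5, h6, hsp b₁, hone b₁ ha₁ hU₁ hg₁⟩

end Modular

/-! ### Lattices as ternary forms; construction of splittings. -/

section Frame

variable {O K V : Type*} [CommRing O] [Field K] [Algebra O K]
  [AddCommGroup V] [Module K V] [Module O V] [IsScalarTower O K V]

/-- The vectors `e₁, e₂, e₃` generate `L`, the last one is orthogonal to the other two, and the
values of `Q` on their combinations are given by `ternary A H C E`. -/
structure IsFrame (Q : QuadraticForm K V) (L : Submodule O V) (e₁ e₂ e₃ : V) (A H C E : O) :
    Prop where
  span_eq : Submodule.span O {e₁, e₂, e₃} = L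
  map_fst : Q e₁ = algebraMap O K A
  map_snd : Q e₂ = algebraMap O K C
  map_trd : Q e₃ = algebraMap O K E
  two_mul_bil : 2 * bil Q e₁ e₂ = algebraMap O K H
  bil_fst_trd : bil Q e₁ e₃ = 0
  bil_snd_trd : bil Q e₂ e₃ = 0

variable [CharZero K] {Q : QuadraticForm K V} {L : Submodule O V} {e₁ e₂ e₃ : V} {A H C E : O}

theorem IsFrame.map_eq (h : IsFrame Q L e₁ e₂ e₃ A H C E) (x y z : O) :
    Q (x • e₁ + y • e₂ + z • e₃) = algebraMap O K (ternary A H C E x y z) := by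
  rw [map_add_eq, map_add_eq, bil_add_left]
  simp only [bil_smul_left, bil_smul_right, map_smul_sq, h.map_fst, h.map_snd, h.map_trd,
    h.bil_fst_trd, h.bil_snd_trd, ternary, map_add, map_mul, map_pow]
  linear_combination (algebraMap O K x * algebraMap O K y) * h.two_mul_bil

theorem IsFrame.mem_iff (h : IsFrame Q L e₁ e₂ e₃ A H C E) {w : V} :
    w ∈ L ↔ ∃ x y z : O, x • e₁ + y • e₂ + z • e₃ = w := by
  rw [← h.span_eq, Submodule.mem_span_triple]

theorem IsFrame.isUniversal_iff [IsFractionRing O K] (h : IsFrame Q L e₁ e₂ e₃ A H C E) :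
    IsUniversal Q L ↔ ∀ t, ∃ x y z, ternary A H C E x y z = t := by
  constructor
  · intro hu t
    obtain ⟨w, hw, ht⟩ : algebraMap O K t ∈ {c : K | ∃ x ∈ L, Q x = c} := by
      rw [hu]; exact ⟨t, rfl⟩
    obtain ⟨x, y, z, rfl⟩ := h.mem_iff.1 hw
    rw [h.map_eq] at ht
    exact ⟨x, y, z, IsFractionRing.injective O K ht⟩
  · intro hu
    ext c
    constructor
    · rintro ⟨w, hw, rfl⟩
      obtain ⟨x, y, z, rfl⟩ := h.mem_iff.1 hw
      exact ⟨_, (h.map_eq x y z).symm⟩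
    · rintro ⟨t, rfl⟩
      obtain ⟨x, y, z, rfl⟩ := hu t
      exact ⟨_, h.mem_iff.2 ⟨x, y, z, rfl⟩, h.map_eq x y z⟩

theorem IsFrame.swap (h : IsFrame Q L e₁ e₂ e₃ A H C E) : IsFrame Q L e₂ e₁ e₃ C H A E where
  span_eq := by rw [← h.span_eq, Set.insert_comm]
  map_fst := h.map_snd
  map_snd := h.map_fst
  map_trd := h.map_trd
  two_mul_bil := by rw [bil_comm, h.two_mul_bil]
  bil_fst_trd := h.bil_snd_trd
  bil_snd_trd := h.bil_fst_trd

theorem IsFrame.span_eq_top (h : IsFrame Q L e₁ e₂ e₃ A H C E) (hL : L.IsLattice K) :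
    ⊤ ≤ Submodule.span K (Set.range ![e₁, e₂, e₃]) := by
  rw [← hL.span_eq_top, Submodule.span_le, ← h.span_eq]
  have : Set.range ![e₁, e₂, e₃] = {e₁, e₂, e₃} := by
    ext v; simp [eq_comm]; tauto
  rw [this]
  exact Submodule.span_subset_span O K _

theorem IsFrame.not_anisotropic [IsDomain O] [IsFractionRing O K]
    (hV : Module.finrank K V = 3) (hL : L.IsLattice K)
    (h : IsFrame Q L e₁ e₂ e₃ A H C E) {x y z : O} (h0 : ¬ (x = 0 ∧ y = 0 ∧ z = 0))
    (hiso : ternary A H C E x y z = 0) : ¬ Q.Anisotropic := by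
  intro han
  have hli := linearIndependent_of_top_le_span_of_card_eq_finrank (h.span_eq_top hL)
    (by rw [hV]; rfl)
  rw [← LinearIndependent.iff_fractionRing O K] at hli
  have h1 := han _ ((h.map_eq x y z).trans (by rw [hiso, map_zero]))
  have h2 := Fintype.linearIndependent_iff.1 hli ![x, y, z] (by
    rw [Fin.sum_univ_three]; exact h1)
  exact h0 ⟨h2 0, h2 1, h2 2⟩

theorem IsFrame.exists_isotropic [IsDomain O] [IsFractionRing O K] (hL : L.IsLattice K)
    (h : IsFrame Q L e₁ e₂ e₃ A H C E) (hiso : ¬ Q.Anisotropic) :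
    ∃ x y z : O, ¬ (x = 0 ∧ y = 0 ∧ z = 0) ∧ ternary A H C E x y z = 0 := by
  simp only [QuadraticMap.Anisotropic, not_forall] at hiso
  obtain ⟨w, hw, hw0⟩ := hiso
  have hwm := h.span_eq_top hL (Submodule.mem_top (x := w))
  rw [Submodule.mem_span_range_iff_exists_fun] at hwm
  obtain ⟨k, hk⟩ := hwm
  obtain ⟨c, hc⟩ := IsLocalization.exist_integer_multiples_of_finite (nonZeroDivisors O) k
  choose n hn using hc
  have hwc : n 0 • e₁ + n 1 • e₂ + n 2 • e₃ = (c : O) • w := by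
    rw [← hk, Fin.sum_univ_three, smul_add, smul_add, algebra_compatible_smul K (n 0),
      algebra_compatible_smul K (n 1), algebra_compatible_smul K (n 2), hn, hn, hn]
    simp
  have hc0 : (c : O) ≠ 0 := nonZeroDivisors.coe_ne_zero c
  refine ⟨n 0, n 1, n 2, ?_, ?_⟩
  · rintro ⟨h0, h1, h2⟩
    rw [h0, h1, h2] at hwc
    have h3 : algebraMap O K c • w = 0 := by rw [algebraMap_smul, ← hwc]; simp
    rcases smul_eq_zero.1 h3 with h4 | h4
    · exact hc0 (IsFractionRing.injective O K (h4.trans (map_zero _).symm))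
    · exact hw0 h4
  · apply IsFractionRing.injective O K
    rw [← h.map_eq, hwc, map_smul_sq, hw, mul_zero, map_zero]

/-- The middle generator occurs because `2B(x, y) = Q(x + y) - Q(x) - Q(y)`. -/
theorem norm_span_pair {x y : V} (hx : Q x = algebraMap O K A)
    (hxy : 2 * bil Q x y = algebraMap O K H) (hy : Q y = algebraMap O K C) :
    norm Q (Submodule.span O {x, y}) =
      Submodule.map (Algebra.linearMap O K) (Ideal.span {A, H, C}) := by
  apply le_antisymm
  · unfold norm
    rw [Submodule.span_le]
    rintro _ ⟨v, hv, rfl⟩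
    obtain ⟨p, q, rfl⟩ := Submodule.mem_span_pair.1 hv
    refine ⟨A * p ^ 2 + H * (p * q) + C * q ^ 2, ?_, ?_⟩
    · refine add_mem (add_mem ?_ ?_) ?_ <;>
        exact Ideal.mul_mem_right _ _ (Ideal.subset_span (by simp))
    · rw [map_add_eq]
      simp only [map_smul_sq, bil_smul_left, bil_smul_right, hx, hy, Algebra.linearMap_apply,
        map_add, map_mul, map_pow]
      linear_combination (-algebraMap O K p * algebraMap O K q) * hxy
  · rw [Submodule.map_le_iff_le_comap, Ideal.span, Submodule.span_le]
    have hq : ∀ v ∈ Submodule.span O {x, y}, Q v ∈ norm Q (Submodule.span O {x, y}) :=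
      fun v hv => Submodule.subset_span ⟨v, hv, rfl⟩
    have hxm : x ∈ Submodule.span O {x, y} := Submodule.subset_span (.inl rfl)
    have hym : y ∈ Submodule.span O {x, y} := Submodule.subset_span (.inr rfl)
    rintro _ (rfl | rfl | rfl)
    · simpa [hx] using hq x hxm
    · have := sub_mem (sub_mem (hq _ (add_mem hxm hym)) (hq x hxm)) (hq y hym)
      rw [map_add_eq, show Q x + Q y + 2 * bil Q x y - Q x - Q y = 2 * bil Q x y by ring,
        hxy] at this
      simpa using this
    · simpa [hy] using hq y hym

theorem norm_span_singleton {z : V} (hz : Q z = algebraMap O K E) :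
    norm Q (Submodule.span O {z}) = Submodule.map (Algebra.linearMap O K) (Ideal.span {E}) := by
  have := norm_span_pair (x := z) (y := z) (H := 2 * E) (C := E) hz
    (by rw [bil_self, hz, map_mul, map_ofNat]) hz
  rw [Set.pair_eq_singleton] at this
  rw [this]
  congr 1
  apply le_antisymm
  · rw [Ideal.span_le]
    rintro _ (rfl | rfl | rfl)
    · exact Ideal.subset_span rfl
    · exact Ideal.mul_mem_left _ _ (Ideal.subset_span rfl)
    · exact Ideal.subset_span rfl
  · exact Ideal.span_mono (by simp)

/-- If the norm of `L` is the unit ideal, then one of the coefficients is a unit. -/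
theorem IsFrame.exists_isUnit [IsFractionRing O K] [IsLocalRing O]
    (h : IsFrame Q L e₁ e₂ e₃ A H C E) (hn : norm Q L = 1) :
    IsUnit A ∨ IsUnit H ∨ IsUnit C ∨ IsUnit E := by
  by_contra hcon
  simp only [not_or, ← mem_nonunits_iff, ← IsLocalRing.mem_maximalIdeal] at hcon
  obtain ⟨hA, hH, hC, hE⟩ := hcon
  have hle : norm Q L ≤ Submodule.map (Algebra.linearMap O K) (IsLocalRing.maximalIdeal O) := by
    unfold norm
    rw [Submodule.span_le]
    rintro _ ⟨w, hw, rfl⟩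
    obtain ⟨x, y, z, rfl⟩ := h.mem_iff.1 hw
    rw [h.map_eq]
    refine ⟨_, ?_, rfl⟩
    unfold ternary
    refine add_mem (add_mem (add_mem ?_ ?_) ?_) ?_
    · exact Ideal.mul_mem_right _ _ hA
    · exact Ideal.mul_mem_right _ _ (Ideal.mul_mem_right _ _ hH)
    · exact Ideal.mul_mem_right _ _ hC
    · exact Ideal.mul_mem_right _ _ hE
  have h1 : (1 : K) ∈ norm Q L := by rw [hn]; exact Submodule.one_le.1 le_rfl
  obtain ⟨c, hc, hc1⟩ := hle h1
  rw [Algebra.linearMap_apply, ← map_one (algebraMap O K)] at hc1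
  rw [IsFractionRing.injective O K hc1] at hc
  exact (Ideal.ne_top_iff_one _).1 (IsLocalRing.maximalIdeal.isMaximal O).ne_top hc

/-- In a lattice of rank three a binary modular sublattice with minimal scale splits. -/
theorem exists_isJordanSplitting [IsDomain O] [IsFractionRing O K]
    (hV : Module.finrank K V = 3) (hQ : Q.polarBilin.Nondegenerate) (hL : L.IsLattice K)
    {x y z : V} {G : K} {α β p q : O} (hG : G ≠ 0) (hu : IsUnit (1 - α * β))
    (hx : Q x = G * algebraMap O K α) (hxy : bil Q x y = G) (hy : Q y = G * algebraMap O K β)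
    (hxz : bil Q x z = G * algebraMap O K p) (hyz : bil Q y z = G * algebraMap O K q)
    (hspan : Submodule.span O {x, y} ⊔ Submodule.span O {z} = L)
    (hval : ∀ w ∈ L, ∃ m : O, ¬ IsUnit m ∧ Q w = G * algebraMap O K m) :
    ∃ z', IsJordanSplitting Q L ![Submodule.span O {x, y}, Submodule.span O {z'}] := by
  obtain ⟨n, hn⟩ := hu.exists_left_inv
  -- Cramer's rule: `c x + d y` is the orthogonal projection of `z` to the binary lattice, integral
  -- because `1 - αβ` is a unit.
  obtain ⟨d, hd⟩ : ∃ d, d = n * (p - q * α) := ⟨_, rfl⟩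
  obtain ⟨c, hc⟩ : ∃ c, c = n * (q - p * β) := ⟨_, rfl⟩
  have hcd1 : c * α + d = p := by rw [hc, hd]; linear_combination p * hn
  have hcd2 : c + d * β = q := by rw [hc, hd]; linear_combination q * hn
  obtain ⟨z', hz'⟩ : ∃ z', z' = z + (-c) • x + (-d) • y := ⟨_, rfl⟩
  have hxz' : bil Q x z' = 0 := by
    rw [hz', bil_add_right, bil_add_right, bil_smul_right, bil_smul_right, bil_self, hxz, hx,
      hxy, ← hcd1]
    simp only [map_add, map_mul, map_neg]; ring
  have hyz' : bil Q y z' = 0 := by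
    rw [hz', bil_add_right, bil_add_right, bil_smul_right, bil_smul_right, bil_self, hyz, hy,
      bil_comm Q y x, hxy, ← hcd2]
    simp only [map_add, map_mul, map_neg]; ring
  have hspan' : Submodule.span O {x, y} ⊔ Submodule.span O {z'} = L := by
    rw [← hspan]
    have hxm : ∀ N : Submodule O V, x ∈ Submodule.span O {x, y} ⊔ N := fun N =>
      Submodule.mem_sup_left (Submodule.subset_span (.inl rfl))
    have hym : ∀ N : Submodule O V, y ∈ Submodule.span O {x, y} ⊔ N := fun N =>
      Submodule.mem_sup_left (Submodule.subset_span (.inr rfl))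
    apply le_antisymm
    · refine sup_le le_sup_left ?_
      rw [Submodule.span_singleton_le_iff_mem, hz']
      exact add_mem (add_mem (Submodule.mem_sup_right (Submodule.mem_span_singleton_self z))
        (Submodule.smul_mem _ _ (hxm _))) (Submodule.smul_mem _ _ (hym _))
    · refine sup_le le_sup_left ?_
      rw [Submodule.span_singleton_le_iff_mem, show z = z' + c • x + d • y by rw [hz']; module]
      exact add_mem (add_mem (Submodule.mem_sup_right (Submodule.mem_span_singleton_self z'))
        (Submodule.smul_mem _ _ (hxm _))) (Submodule.smul_mem _ _ (hym _))
  have horth : Orth Q (Submodule.span O {x, y}) (Submodule.span O {z'}) := by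
    intro v hv w hw
    obtain ⟨r, s, rfl⟩ := Submodule.mem_span_pair.1 hv
    obtain ⟨t, rfl⟩ := Submodule.mem_span_singleton.1 hw
    rw [bil_add_left, bil_smul_left, bil_smul_left, bil_smul_right, bil_smul_right, hxz', hyz']
    simp
  -- If `Q z'` vanished, `z'` would lie in the radical, hence be zero, and two vectors would span
  -- the space.
  have hz0 : Q z' ≠ 0 := by
    intro h0
    have hker : ∀ w ∈ L, Q.polarBilin z' w = 0 := by
      intro w hw
      rw [← hspan'] at hw
      obtain ⟨v, hv, t, ht, rfl⟩ := Submodule.mem_sup.1 hw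
      obtain ⟨t, rfl⟩ := Submodule.mem_span_singleton.1 ht
      have : bil Q z' (v + t • z') = 0 := by
        rw [bil_add_right, bil_smul_right, bil_self, h0, bil_comm, horth v hv z'
          (Submodule.mem_span_singleton_self z')]
        simp
      rwa [bil_eq_polarBilin, div_eq_zero_iff, or_iff_left two_ne_zero] at this
    have hker' : Submodule.span K (L : Set V) ≤ LinearMap.ker (Q.polarBilin z') := by
      rw [Submodule.span_le]
      exact fun w hw => hker w hw
    rw [hL.span_eq_top] at hker'
    have hzz : z' = 0 := hQ.1 z' fun w => hker' (Submodule.mem_top (x := w))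
    have htop : (⊤ : Submodule K V) ≤ Submodule.span K ({x, y} : Set V) := by
      rw [← hL.span_eq_top, Submodule.span_le, ← hspan', hzz, Submodule.span_zero_singleton,
        sup_bot_eq]
      exact Submodule.span_subset_span O K _
    classical
    have h1 := finrank_span_finset_le_card (R := K) ({x, y} : Finset V)
    rw [Set.finrank, Finset.coe_pair, top_le_iff.1 htop, finrank_top, hV] at h1
    have h2 := Finset.card_le_two (a := x) (b := y)
    omega
  have hz'L : z' ∈ L := by
    rw [← hspan']; exact Submodule.mem_sup_right (Submodule.mem_span_singleton_self z')
  refine ⟨z', ?_, ?_, ?_, ?_, ?_⟩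
  · rw [← hspan']
    apply le_antisymm
    · exact iSup_le (Fin.forall_fin_two.2 ⟨le_sup_left, le_sup_right⟩)
    · exact sup_le
        (le_iSup ![Submodule.span O {x, y}, Submodule.span O {z'}] 0)
        (le_iSup ![Submodule.span O {x, y}, Submodule.span O {z'}] 1)
  · rw [Fin.forall_fin_two]
    simp only [Fin.forall_fin_two]
    refine ⟨⟨fun h => absurd rfl h, fun _ => horth⟩, fun _ => ?_, fun h => absurd rfl h⟩
    intro v hv w hw
    rw [bil_comm]; exact horth w hw v hv
  · rw [Fin.forall_fin_two]
    refine ⟨fun h => hG ?_, fun h => hz0 ?_⟩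
    · have : x ∈ (⊥ : Submodule O V) := h ▸ Submodule.subset_span (.inl rfl)
      rw [Submodule.mem_bot] at this
      rw [← hxy, this]; simp [bil]
    · have : z' ∈ (⊥ : Submodule O V) := h ▸ Submodule.mem_span_singleton_self z'
      rw [Submodule.mem_bot] at this
      rw [this, QuadraticMap.map_zero]
  · rw [Fin.forall_fin_two]
    exact ⟨isModular_span_pair hG hu hx hxy hy, isModular_span_singleton hz0⟩
  · intro i j hij
    obtain ⟨rfl, rfl⟩ : i = 0 ∧ j = 1 := by revert i j; decide
    obtain ⟨m, hm, hQm⟩ := hval z' hz'L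
    change scale Q (Submodule.span O {z'}) < scale Q (Submodule.span O {x, y})
    rw [scale_span_pair hx hxy hy, scale_span_singleton]
    exact span_singleton_lt_of_eq hG hm hQm

/-- An isotropic vector `x e₁ + y e₂ + f` with `x` and `H` units belongs to a hyperbolic pair. -/
theorem exists_hyperbolic_pair [IsLocalRing O] (h2 : ¬ IsUnit (2 : O)) {f : V} {x y : O}
    (hH : IsUnit H) (h22 : Q e₂ = algebraMap O K C) (h12 : 2 * bil Q e₁ e₂ = algebraMap O K H)
    (hf : bil Q e₂ f = 0) (hx : IsUnit x) (hiso : Q (x • e₁ + y • e₂ + f) = 0) :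
    ∃ v w, Q v = 0 ∧ Q w = 0 ∧ bil Q v w = 2⁻¹ ∧ ∀ N : Submodule O V, f ∈ N →
      Submodule.span O {v, w} ⊔ N = Submodule.span O {e₁, e₂} ⊔ N := by
  have hu : IsUnit (H * x + 2 * (C * y)) := by
    by_contra hcon
    refine (?_ : ¬ IsUnit (H * x)) (hH.mul hx)
    rw [← mem_nonunits_iff, ← IsLocalRing.mem_maximalIdeal] at *
    rw [show H * x = (H * x + 2 * (C * y)) - 2 * (C * y) by ring]
    exact sub_mem hcon (Ideal.mul_mem_right _ _ h2)
  obtain ⟨u, huu⟩ : ∃ u, u = H * x + 2 * (C * y) := ⟨_, rfl⟩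
  rw [← huu] at hu
  obtain ⟨n, hn⟩ := hu.exists_left_inv
  obtain ⟨m, hm⟩ := hx.exists_left_inv
  obtain ⟨v, hv⟩ : ∃ v, v = x • e₁ + y • e₂ + f := ⟨_, rfl⟩
  -- Subtracting `n C v` from `e₂` cancels its value `C`, since `2B(v, e₂) = u`. The outer factor
  -- `n` normalizes the pairing with `v` to `1/2`.
  obtain ⟨w, hw⟩ : ∃ w, w = n • (e₂ + (-(n * C)) • v) := ⟨_, rfl⟩
  rw [← hv] at hiso
  have hve : 2 * bil Q v e₂ = algebraMap O K u := by
    rw [hv, bil_add_left, bil_add_left, bil_smul_left, bil_smul_left, bil_self, h22,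
      bil_comm Q f, hf, huu]
    simp only [map_add, map_mul, map_ofNat]
    linear_combination algebraMap O K x * h12
  have hn' : algebraMap O K n * algebraMap O K u = 1 := by rw [← map_mul, hn, map_one]
  have hvw : 2 * bil Q v w = 1 := by
    rw [hw, bil_smul_right, bil_add_right, bil_smul_right, bil_self, hiso]
    linear_combination algebraMap O K n * hve + hn'
  refine ⟨v, w, hiso, ?_, ?_, fun N hN => ?_⟩
  · rw [hw, map_smul_sq, map_add_eq, map_smul_sq, hiso, bil_smul_right, h22, bil_comm]
    simp only [map_neg, map_mul]
    linear_combination (-algebraMap O K n ^ 3 * algebraMap O K C) * hve -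
      algebraMap O K n ^ 2 * algebraMap O K C * hn'
  · exact eq_inv_of_mul_eq_one_right hvw
  · have h1 : e₁ ∈ Submodule.span O {e₁, e₂} ⊔ N :=
      Submodule.mem_sup_left (Submodule.subset_span (.inl rfl))
    have h2 : e₂ ∈ Submodule.span O {e₁, e₂} ⊔ N :=
      Submodule.mem_sup_left (Submodule.subset_span (.inr rfl))
    have h3 : v ∈ Submodule.span O {v, w} ⊔ N :=
      Submodule.mem_sup_left (Submodule.subset_span (.inl rfl))
    have h4 : w ∈ Submodule.span O {v, w} ⊔ N :=
      Submodule.mem_sup_left (Submodule.subset_span (.inr rfl))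
    have h5 : v ∈ Submodule.span O {e₁, e₂} ⊔ N := by
      rw [hv]
      exact add_mem (add_mem (Submodule.smul_mem _ _ h1) (Submodule.smul_mem _ _ h2))
        (Submodule.mem_sup_right hN)
    have h6 : e₂ ∈ Submodule.span O {v, w} ⊔ N := by
      have : e₂ = u • w + (n * C) • v := by
        rw [hw, smul_smul, mul_comm u, hn]; module
      rw [this]
      exact add_mem (Submodule.smul_mem _ _ h4) (Submodule.smul_mem _ _ h3)
    apply le_antisymm
    · refine sup_le (Submodule.span_le.2 (Set.pair_subset h5 ?_)) le_sup_right
      rw [hw]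
      exact Submodule.smul_mem _ _ (add_mem h2 (Submodule.smul_mem _ _ h5))
    · refine sup_le (Submodule.span_le.2 (Set.pair_subset ?_ h6)) le_sup_right
      have : e₁ = m • (v - y • e₂ - f) := by
        rw [hv, show x • e₁ + y • e₂ + f - y • e₂ - f = x • e₁ by abel, smul_smul, hm, one_smul]
      rw [this]
      exact Submodule.smul_mem _ _ (sub_mem (sub_mem h3 (Submodule.smul_mem _ _ h6))
        (Submodule.mem_sup_right hN))

/-- An even unimodular binary lattice with a primitive isotropic vector is hyperbolic. -/
theorem isBinary_of_isotropic [IsDomain O] [IsFractionRing O K] [IsLocalRing O]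
    (h2 : ¬ IsUnit (2 : O)) {x y : O} (hH : IsUnit H) (h11 : Q e₁ = algebraMap O K A)
    (h22 : Q e₂ = algebraMap O K C) (h12 : 2 * bil Q e₁ e₂ = algebraMap O K H)
    (hxy : IsUnit x ∨ IsUnit y) (hiso : A * x ^ 2 + H * x * y + C * y ^ 2 = 0) :
    IsBinary Q 2⁻¹ 0 0 (Submodule.span O {e₁, e₂}) := by
  wlog hx : IsUnit x generalizing x y A C e₁ e₂
  · rw [Set.pair_comm]
    exact this h22 h11 (by rw [bil_comm, h12]) hxy.symm (by rw [← hiso]; ring)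
      (hxy.resolve_left hx)
  obtain ⟨v, w, hv, hw, hvw, hN⟩ := exists_hyperbolic_pair (f := 0) (y := y) h2 hH h22 h12
    (by simp [bil]) hx (by
      rw [add_zero, map_add_eq, map_smul_sq, map_smul_sq, bil_smul_left, bil_smul_right, h11, h22]
      rw [← map_zero (algebraMap O K), ← hiso]
      simp only [map_add, map_mul, map_pow]
      linear_combination algebraMap O K x * algebraMap O K y * h12)
  have := hN ⊥ (Submodule.zero_mem _)
  rw [sup_bot_eq, sup_bot_eq] at this
  have h20 : (2⁻¹ : K) ≠ 0 := inv_ne_zero two_ne_zero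
  exact ⟨v, w, linearIndependent_pair_of_gram (α := (0 : O)) (β := 0) h20 (by simp) (by simpa)
    hvw (by simpa), this, by simpa, hvw, by simpa⟩

end Frame

/-! ### Coordinates adapted to a Jordan splitting; use of minimality. -/

section BinaryFrame

variable {O K V : Type*} [CommRing O] [Field K] [Algebra O K]
  [AddCommGroup V] [Module K V] [Module O V] [IsScalarTower O K V]

/-- A frame of `L = L₁ ⊥ L₂` adapted to the Jordan splitting, where `h⁻¹ = B(e₁, e₂)` generates the
scale of `L₁`. -/
structure IsBinaryFrame (Q : QuadraticForm K V) (L L₁ L₂ : Submodule O V) (e₁ e₂ e₃ : V)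
    (A H C E h : O) : Prop extends IsFrame Q L e₁ e₂ e₃ A H C E where
  span_pair : Submodule.span O {e₁, e₂} = L₁
  span_trd : Submodule.span O {e₃} = L₂
  mul_eq_two : H * h = 2
  modular : IsUnit (1 - h ^ 2 * A * C)
  not_isUnit : ¬ IsUnit (h * E)
  ne_zero : E ≠ 0

variable [CharZero K] {Q : QuadraticForm K V} {L L₁ L₂ : Submodule O V}
  {e₁ e₂ e₃ : V} {A H C E h : O}

theorem IsBinaryFrame.swap (hf : IsBinaryFrame Q L L₁ L₂ e₁ e₂ e₃ A H C E h) :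
    IsBinaryFrame Q L L₁ L₂ e₂ e₁ e₃ C H A E h where
  toIsFrame := hf.toIsFrame.swap
  span_pair := by rw [Set.pair_comm, hf.span_pair]
  span_trd := hf.span_trd
  mul_eq_two := hf.mul_eq_two
  modular := by convert hf.modular using 1; ring
  not_isUnit := hf.not_isUnit
  ne_zero := hf.ne_zero

theorem IsFrame.exists_map_eq (hf : IsFrame Q L e₁ e₂ e₃ A H C E) {w : V} (hw : w ∈ L) :
    ∃ t, Q w = algebraMap O K t := by
  obtain ⟨x, y, z, rfl⟩ := hf.mem_iff.1 hw
  exact ⟨_, hf.map_eq x y z⟩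

theorem IsFrame.exists_two_mul_bil_eq (hf : IsFrame Q L e₁ e₂ e₃ A H C E) {v w : V}
    (hv : v ∈ L) (hw : w ∈ L) : ∃ t, 2 * bil Q v w = algebraMap O K t := by
  obtain ⟨a, ha⟩ := hf.exists_map_eq hv
  obtain ⟨b, hb⟩ := hf.exists_map_eq hw
  obtain ⟨c, hc⟩ := hf.exists_map_eq (add_mem hv hw)
  refine ⟨c - a - b, ?_⟩
  rw [map_add_eq, ha, hb] at hc
  rw [map_sub, map_sub, ← hc]; ring

theorem IsFrame.sup_eq (hf : IsFrame Q L e₁ e₂ e₃ A H C E) :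
    Submodule.span O {e₁, e₂} ⊔ Submodule.span O {e₃} = L := by
  rw [← hf.span_eq, ← Submodule.span_union]
  congr 1
  ext v; simp; tauto

theorem exists_map_eq_of_norm_eq_one (hn : norm Q L = 1) {w : V} (hw : w ∈ L) :
    ∃ t, Q w = algebraMap O K t := by
  have : Q w ∈ norm Q L := Submodule.subset_span ⟨w, hw, rfl⟩
  rw [hn, Submodule.one_eq_range] at this
  obtain ⟨t, ht⟩ := this
  exact ⟨t, ht.symm⟩

/-- Every value of `Q` lies in the scale `G O` of `L₁`, so norm one gives `1 = h G` with `h`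
integral. Then `α = h A` and `β = h C`, and the strict inclusion of scales says that `h E` is not a
unit. -/
theorem exists_isBinaryFrame [IsDomain O] [IsFractionRing O K]
    (hJ : IsJordanSplitting Q L ![L₁, L₂]) (hn : norm Q L = 1) {x y z : V} {G : K} {α β : O}
    (hG : G ≠ 0) (hu : IsUnit (1 - α * β)) (hspan : Submodule.span O {x, y} = L₁)
    (hx : Q x = G * algebraMap O K α) (hxy : bil Q x y = G)
    (hy : Q y = G * algebraMap O K β) (hspan' : Submodule.span O {z} = L₂) (hz : Q z ≠ 0) :
    ∃ A H C E h, IsBinaryFrame Q L L₁ L₂ x y z A H C E h := by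
  have hlt : scale Q L₂ < scale Q L₁ := hJ.scale_lt 0 1 (by decide)
  rw [← hspan, ← hspan', scale_span_pair hx hxy hy, scale_span_singleton] at hlt
  obtain ⟨m, hm, hzm⟩ := span_singleton_lt hlt
  have hxm : x ∈ L₁ := hspan ▸ Submodule.subset_span (.inl rfl)
  have hym : y ∈ L₁ := hspan ▸ Submodule.subset_span (.inr rfl)
  have hzm' : z ∈ L₂ := hspan' ▸ Submodule.mem_span_singleton_self z
  have hle₁ : L₁ ≤ L := hJ.sup_eq ▸ le_sup_left
  have hle₂ : L₂ ≤ L := hJ.sup_eq ▸ le_sup_right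
  have horth : Orth Q L₁ L₂ := hJ.orth 0 1 (by decide)
  have hxz := horth x hxm z hzm'
  have hyz := horth y hym z hzm'
  have hspanL : Submodule.span O {x, y, z} = L := by
    rw [← hJ.sup_eq, ← hspan, ← hspan', ← Submodule.span_union]
    congr 1
    ext v; simp; tauto
  obtain ⟨A, hA⟩ := exists_map_eq_of_norm_eq_one hn (hle₁ hxm)
  obtain ⟨C, hC⟩ := exists_map_eq_of_norm_eq_one hn (hle₁ hym)
  obtain ⟨E, hE⟩ := exists_map_eq_of_norm_eq_one hn (hle₂ hzm')
  obtain ⟨T, hT⟩ := exists_map_eq_of_norm_eq_one hn (hle₁ (add_mem hxm hym))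
  have hle : norm Q L ≤ Submodule.span O {G} := by
    unfold norm
    rw [Submodule.span_le]
    rintro _ ⟨w, hw, rfl⟩
    rw [← hspanL] at hw
    obtain ⟨p, q, r, rfl⟩ := Submodule.mem_span_triple.1 hw
    rw [SetLike.mem_coe, Submodule.mem_span_singleton]
    refine ⟨α * p ^ 2 + 2 * p * q + β * q ^ 2 + m * r ^ 2, ?_⟩
    rw [map_add_eq, map_add_eq, bil_add_left]
    simp only [bil_smul_left, bil_smul_right, map_smul_sq, hx, hy, hzm, hxz, hyz, hxy,
      Algebra.smul_def, map_add, map_mul, map_pow, map_ofNat]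
    ring
  have h1 : (1 : K) ∈ norm Q L := by rw [hn]; exact Submodule.one_le.1 le_rfl
  obtain ⟨h, hh⟩ := Submodule.mem_span_singleton.1 (hle h1)
  rw [Algebra.smul_def] at hh
  have hinj := IsFractionRing.injective O K
  have hα : α = h * A := hinj (mul_left_cancel₀ hG (by
    rw [map_mul, ← hx, hA]; linear_combination (-algebraMap O K A) * hh))
  have hβ : β = h * C := hinj (mul_left_cancel₀ hG (by
    rw [map_mul, ← hy, hC]; linear_combination (-algebraMap O K C) * hh))
  have hmE : m = h * E := hinj (mul_left_cancel₀ hG (by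
    rw [map_mul, ← hzm, hE]; linear_combination (-algebraMap O K E) * hh))
  have hH : 2 * bil Q x y = algebraMap O K (T - A - C) := by
    rw [map_sub, map_sub, ← hT, ← hA, ← hC, map_add_eq]; ring
  refine ⟨A, T - A - C, C, E, h, ⟨⟨hspanL, hA, hC, hE, hH, hxz, hyz⟩, hspan, hspan', ?_, ?_, ?_, ?_⟩⟩
  · apply hinj
    rw [map_mul, ← hH, hxy, map_ofNat]; linear_combination 2 * hh
  · rw [hα, hβ] at hu
    convert hu using 1; ring
  · rwa [← hmE]
  · rintro rfl
    rw [map_zero] at hE; exact hz hE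

theorem IsBinaryFrame.bil_mul (hf : IsBinaryFrame Q L L₁ L₂ e₁ e₂ e₃ A H C E h) :
    bil Q e₁ e₂ * algebraMap O K h = 1 := by
  have h1 := congrArg (algebraMap O K) hf.mul_eq_two
  rw [map_mul, ← hf.two_mul_bil, map_ofNat] at h1
  apply mul_left_cancel₀ (two_ne_zero (α := K))
  linear_combination h1

theorem maximalIdeal_smul_eq_iff [IsLocalRing O] [IsFractionRing O K] {I J : Ideal O} :
    IsLocalRing.maximalIdeal O • Submodule.map (Algebra.linearMap O K) I =
      Submodule.map (Algebra.linearMap O K) J ↔ IsLocalRing.maximalIdeal O * I = J := by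
  rw [← Submodule.map_smul'', (Submodule.map_injective_of_injective
    (f := Algebra.linearMap O K) (IsFractionRing.injective O K)).eq_iff, smul_eq_mul]

section DVR

variable [IsDomain O] [IsFractionRing O K] [IsDiscreteValuationRing O] {π : O}

/-- In a minimal norm splitting of norm one, the norm of `L₁` is smaller than one if `L₂` is
unimodular and `B(e₁, e₂) ∉ 2⁻¹ O`. -/
theorem IsBinaryFrame.not_isUnit_fst [Finite (IsLocalRing.ResidueField O)]
    (hV : Module.finrank K V = 3) (hQ : Q.polarBilin.Nondegenerate) (hL : L.IsLattice K)
    (hπ : Irreducible π) (h2 : π ∣ 2)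
    (hJ : IsMinimalNormJordanSplitting Q L ![L₁, L₂])
    (hf : IsBinaryFrame Q L L₁ L₂ e₁ e₂ e₃ A H C E h) (hH : π ∣ H) (hE : IsUnit E) :
    ¬ IsUnit A := by
  intro hA
  -- Adding multiples of `e₃` to `e₁` and `e₂` makes both values divisible by `π`, as `E` is a unit.
  -- Since `π ∣ h`, the new pair still spans a modular lattice of the same scale; it splits `L` and
  -- has norm inside `(π)`, against minimality.
  obtain ⟨l, hl⟩ := exists_dvd_sub_sq hπ h2 hE.neg A
  obtain ⟨m, hm⟩ := exists_dvd_sub_sq hπ h2 hE.neg C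
  have hh : π ∣ h := by
    by_contra hh
    exact hf.not_isUnit (((isUnit_iff_not_dvd hπ).2 hh).mul hE)
  obtain ⟨G, hG⟩ : ∃ G, G = bil Q e₁ e₂ := ⟨_, rfl⟩
  have hGh := hf.bil_mul
  rw [← hG] at hGh
  have hu : IsUnit (1 + h * (l * m * E)) :=
    isUnit_add_of_dvd hπ isUnit_one (hh.mul_right _)
  obtain ⟨n, hn⟩ := hu.exists_left_inv
  have hn' : algebraMap O K n * (1 + algebraMap O K h * (algebraMap O K l * algebraMap O K m *
      algebraMap O K E)) = 1 := by
    have := congrArg (algebraMap O K) hn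
    simpa only [map_mul, map_add, map_one] using this
  have hG0 : G ≠ 0 := left_ne_zero_of_mul_eq_one hGh
  have hxy : bil Q (e₁ + l • e₃) (e₂ + m • e₃) = G * algebraMap O K (1 + h * (l * m * E)) := by
    simp only [bil_add_left, bil_add_right, bil_smul_left, bil_smul_right, bil_self,
      hf.bil_fst_trd, bil_comm Q e₃ e₂, hf.bil_snd_trd, hf.map_trd, ← hG, map_add, map_mul,
      map_one]
    linear_combination (-(algebraMap O K l * algebraMap O K m * algebraMap O K E)) * hGh
  have key : ∀ t, algebraMap O K t = G * algebraMap O K (1 + h * (l * m * E)) *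
      algebraMap O K (h * (n * t)) := by
    intro t
    simp only [map_mul, map_add, map_one]
    linear_combination (-algebraMap O K t) * hn' - algebraMap O K t * algebraMap O K n *
      (1 + algebraMap O K h * (algebraMap O K l * algebraMap O K m * algebraMap O K E)) * hGh
  have hx : Q (e₁ + l • e₃) = algebraMap O K (A + E * l ^ 2) := by
    rw [map_add_eq, map_smul_sq, bil_smul_right, hf.bil_fst_trd, hf.map_fst, hf.map_trd]
    simp only [map_mul, map_add, map_pow]; ring
  have hy : Q (e₂ + m • e₃) = algebraMap O K (C + E * m ^ 2) := by
    rw [map_add_eq, map_smul_sq, bil_smul_right, hf.bil_snd_trd, hf.map_snd, hf.map_trd]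
    simp only [map_mul, map_add, map_pow]; ring
  have hxz : bil Q (e₁ + l • e₃) e₃ = algebraMap O K (l * E) := by
    rw [bil_add_left, bil_smul_left, hf.bil_fst_trd, bil_self, hf.map_trd, map_mul, zero_add]
  have hyz : bil Q (e₂ + m • e₃) e₃ = algebraMap O K (m * E) := by
    rw [bil_add_left, bil_smul_left, hf.bil_snd_trd, bil_self, hf.map_trd, map_mul, zero_add]
  have hnu : ∀ t, ¬ IsUnit (h * t) := fun t => by
    rw [isUnit_iff_not_dvd hπ, not_not]; exact hh.mul_right _
  obtain ⟨z', hJ'⟩ := exists_isJordanSplitting hV hQ hL (z := e₃)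
    (mul_ne_zero hG0 (hu.map _).ne_zero)
    (α := h * (n * (A + E * l ^ 2))) (β := h * (n * (C + E * m ^ 2))) (by
      rw [sub_eq_add_neg]
      exact isUnit_add_of_dvd hπ isUnit_one ((hh.mul_right _).mul_right _).neg_right)
    (hx.trans (key _)) hxy (hy.trans (key _)) (hxz.trans (key _)) (hyz.trans (key _)) (by
      rw [← hf.sup_eq]
      have h3 : ∀ N : Submodule O V, e₃ ∈ N ⊔ Submodule.span O {e₃} := fun N =>
        Submodule.mem_sup_right (Submodule.mem_span_singleton_self _)
      apply le_antisymm
      · refine sup_le (Submodule.span_le.2 (Set.pair_subset ?_ ?_)) le_sup_right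
        · exact add_mem (Submodule.mem_sup_left (Submodule.subset_span (.inl rfl)))
            (Submodule.smul_mem _ _ (h3 _))
        · exact add_mem (Submodule.mem_sup_left (Submodule.subset_span (.inr rfl)))
            (Submodule.smul_mem _ _ (h3 _))
      · refine sup_le (Submodule.span_le.2 (Set.pair_subset ?_ ?_)) le_sup_right
        · exact (Submodule.add_mem_iff_left _ (Submodule.smul_mem _ l (h3 _))).1
            (Submodule.mem_sup_left (Submodule.subset_span (.inl rfl)))
        · exact (Submodule.add_mem_iff_left _ (Submodule.smul_mem _ m (h3 _))).1
            (Submodule.mem_sup_left (Submodule.subset_span (.inr rfl))))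
    (fun w hw => by
      obtain ⟨t, ht⟩ := hf.exists_map_eq hw
      exact ⟨_, hnu _, ht.trans (key t)⟩)
  have hle : norm Q L₁ ≤ norm Q (Submodule.span O {e₁ + l • e₃, e₂ + m • e₃}) :=
    hJ.norm_le _ hJ' 0
  have hH' : 2 * bil Q (e₁ + l • e₃) (e₂ + m • e₃) = algebraMap O K (H + 2 * (l * m * E)) := by
    rw [hxy, map_add (algebraMap O K) H, ← hf.two_mul_bil, ← hG]
    simp only [map_add, map_mul, map_one, map_ofNat]
    linear_combination (2 * (algebraMap O K l * algebraMap O K m * algebraMap O K E)) * hGh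
  rw [norm_span_pair hx hH' hy, ← hf.span_pair,
    norm_span_pair hf.map_fst hf.two_mul_bil hf.map_snd] at hle
  have hle' := (Submodule.map_le_map_iff_of_injective (f := Algebra.linearMap O K)
    (IsFractionRing.injective O K) _ _).1 hle
  have hAm : A ∈ Ideal.span {π} := by
    refine (hle'.trans (Ideal.span_le.2 ?_)) (Ideal.subset_span (Set.mem_insert _ _))
    simp only [Set.insert_subset_iff, Set.singleton_subset_iff, SetLike.mem_coe,
      Ideal.mem_span_singleton]
    refine ⟨?_, dvd_add hH (h2.mul_right _), ?_⟩
    · convert hl using 1; ring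
    · convert hm using 1; ring
  exact (isUnit_iff_not_dvd hπ).1 hA (Ideal.mem_span_singleton.1 hAm)

theorem IsBinaryFrame.isBinary_of_primitive (hπ : Irreducible π) (h2 : π ∣ 2)
    (hf : IsBinaryFrame Q L L₁ L₂ e₁ e₂ e₃ A H C E h) (hH : IsUnit H) {x y : O}
    (hxy : ¬ (π ∣ x ∧ π ∣ y)) (hiso : A * x ^ 2 + H * x * y + C * y ^ 2 = 0) :
    IsBinary Q 2⁻¹ 0 0 L₁ := by
  rw [← hf.span_pair]
  refine isBinary_of_isotropic (by rwa [isUnit_iff_not_dvd hπ, not_not]) hH hf.map_fst hf.map_snd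
    hf.two_mul_bil ?_ hiso
  rw [isUnit_iff_not_dvd hπ, isUnit_iff_not_dvd hπ]
  tauto

/-- If an even unimodular hyperbolic plane splits `L`, it splits `L₁` by minimality. -/
theorem IsBinaryFrame.isBinary_of_minimal
    (hV : Module.finrank K V = 3) (hQ : Q.polarBilin.Nondegenerate) (hL : L.IsLattice K)
    (hπ : Irreducible π) (h2 : π ∣ 2) (hJ : IsMinimalNormJordanSplitting Q L ![L₁, L₂])
    (hf : IsBinaryFrame Q L L₁ L₂ e₁ e₂ e₃ A H C E h) (hH : IsUnit H) {x y z : O}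
    (hxy : ¬ (π ∣ x ∧ π ∣ y)) (hiso : ternary A H C E x y z = 0) :
    IsBinary Q 2⁻¹ 0 0 L₁ := by
  wlog hx : IsUnit x generalizing x y A C e₁ e₂
  · refine this hf.swap (x := y) (y := x) (by tauto) (by rw [← ternary_swap, hiso]) ?_
    rw [isUnit_iff_not_dvd hπ] at hx ⊢; tauto
  have h2u : ¬ IsUnit (2 : O) := by rwa [isUnit_iff_not_dvd hπ, not_not]
  obtain ⟨v, w, hv, hw, hvw, hN⟩ := exists_hyperbolic_pair (f := z • e₃) (y := y) h2u hH
    hf.map_snd hf.two_mul_bil (by rw [bil_smul_right, hf.bil_snd_trd, mul_zero]) hx (by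
      rw [hf.map_eq, hiso, map_zero])
  have hsup := hN _ (Submodule.smul_mem _ z (Submodule.mem_span_singleton_self e₃))
  rw [hf.sup_eq] at hsup
  have h20 : (2⁻¹ : K) ≠ 0 := inv_ne_zero two_ne_zero
  have hle : ∀ {u}, u ∈ Submodule.span O {v, w} → u ∈ L := fun hu =>
    hsup ▸ Submodule.mem_sup_left hu
  have hvm : v ∈ Submodule.span O {v, w} := Submodule.subset_span (.inl rfl)
  have hwm : w ∈ Submodule.span O {v, w} := Submodule.subset_span (.inr rfl)
  have hem : e₃ ∈ L := hsup ▸ Submodule.mem_sup_right (Submodule.mem_span_singleton_self _)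
  obtain ⟨p, hp⟩ := hf.exists_two_mul_bil_eq (hle hvm) hem
  obtain ⟨q, hq⟩ := hf.exists_two_mul_bil_eq (hle hwm) hem
  obtain ⟨z', hJ'⟩ := exists_isJordanSplitting hV hQ hL (z := e₃) (α := 0) (β := 0) (p := p)
    (q := q) h20 (by simp) (by simpa using hv) hvw (by simpa using hw)
    (by rw [← hp]; field_simp) (by rw [← hq]; field_simp) hsup
    (fun u hu => by
      obtain ⟨t, ht⟩ := hf.exists_map_eq hu
      exact ⟨2 * t, fun hu => h2u (isUnit_of_mul_isUnit_left hu), by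
        rw [ht, map_mul, map_ofNat]; field_simp⟩)
  have hbin : IsBinary Q (2⁻¹ : K) 0 0 (Submodule.span O {v, w}) :=
    ⟨v, w, linearIndependent_pair_of_gram (α := (0 : O)) (β := 0) h20 (by simp) (by simpa using hv)
      hvw (by simpa using hw), rfl, by simpa using hv, hvw, by simpa using hw⟩
  have hscale : scale Q L₁ = Submodule.span O {(2⁻¹ : K)} := by
    have hb := hf.bil_mul
    have hb0 : bil Q e₁ e₂ ≠ 0 := left_ne_zero_of_mul_eq_one hb
    rw [← hf.span_pair, scale_span_pair (G := bil Q e₁ e₂) (α := h * A) (β := h * C)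
      (by rw [hf.map_fst, map_mul]; linear_combination (-algebraMap O K A) * hb) rfl
      (by rw [hf.map_snd, map_mul]; linear_combination (-algebraMap O K C) * hb)]
    have : bil Q e₁ e₂ = H • (2⁻¹ : K) := by
      rw [Algebra.smul_def, ← hf.two_mul_bil]; field_simp
    rw [this]
    exact Submodule.span_singleton_smul_eq hH _
  obtain ⟨P, N, hP, -, -, hPN⟩ := hJ.hyperbolic _ hJ' 0 2⁻¹ 1 hscale
    ⟨fun _ => Submodule.span O {v, w}, ⊥, fun _ => hbin,
      fun i j hij => absurd (Subsingleton.elim i j) hij,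
      fun _ a _ b hb => by rw [(Submodule.mem_bot O).1 hb]; simp [bil], by simp⟩
  change (⨆ i, P i) ⊔ N = L₁ at hPN
  obtain ⟨a, b, -, hab, ha, hbab, hb⟩ := hP 0
  have hPle : P 0 ≤ L₁ := hPN ▸ (le_iSup P 0).trans le_sup_left
  have haL : a ∈ L₁ := hPle (hab ▸ Submodule.subset_span (.inl rfl))
  have hbL : b ∈ L₁ := hPle (hab ▸ Submodule.subset_span (.inr rfl))
  have hLle : L₁ ≤ L := by rw [← hf.sup_eq, hf.span_pair]; exact le_sup_left
  rw [← hf.span_pair] at haL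
  obtain ⟨x', y', rfl⟩ := Submodule.mem_span_pair.1 haL
  refine hf.isBinary_of_primitive hπ h2 hH (x := x') (y := y') ?_ ?_
  -- An isotropic vector of the hyperbolic pair divisible by `π` would put `1 = 2B(a, b)` into
  -- `(π)`.
  · rintro ⟨⟨x₁, rfl⟩, ⟨y₁, rfl⟩⟩
    obtain ⟨t, ht⟩ := hf.exists_two_mul_bil_eq (v := x₁ • e₁ + y₁ • e₂) (w := b)
      (hLle (hf.span_pair ▸ Submodule.mem_span_pair.2 ⟨x₁, y₁, rfl⟩)) (hLle hbL)
    rw [mul_smul, mul_smul, ← smul_add, bil_smul_left] at hbab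
    refine hπ.not_isUnit (.of_mul_eq_one t (IsFractionRing.injective O K ?_))
    rw [map_mul, map_one, ← ht]
    rw [show algebraMap O K π * (2 * bil Q (x₁ • e₁ + y₁ • e₂) b) =
      2 * (algebraMap O K π * bil Q (x₁ • e₁ + y₁ • e₂) b) by ring, hbab]
    field_simp
  · apply IsFractionRing.injective O K
    have := hf.map_eq x' y' 0
    rw [zero_smul, add_zero, ha] at this
    rw [map_zero, ← mul_zero (2⁻¹ : K), this]
    simp [ternary]

end DVR

end BinaryFrame

/-! ### The universality criterion. -/

section Universal

variable {O K V : Type*} [CommRing O] [IsDomain O] [IsDiscreteValuationRing O] [CharZero O]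
  [Finite (IsLocalRing.ResidueField O)] [Field K] [CharZero K] [Algebra O K] [IsFractionRing O K]
  [AddCommGroup V] [Module K V] [Module O V] [IsScalarTower O K V]
  {Q : QuadraticForm K V} {L L₁ L₂ : Submodule O V} {e₁ e₂ e₃ : V} {A H C E h : O}
  {π ε : O} {e : ℕ}

/-- If `L₁` has rank one, then `L` is not universal. -/
theorem not_isUniversal_of_finrank_eq_one (hπ : Irreducible π) (he : (2 : O) = π ^ e * ε)
    (hε : IsUnit ε) (he1 : 1 ≤ e) (hJ : IsJordanSplitting Q L ![L₁, L₂])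
    {x y z : V} {G : K} {α β : O}
    (hu : IsUnit (1 - α * β)) (hspan : Submodule.span O {x, y} = L₂)
    (hx : Q x = G * algebraMap O K α) (hxy : bil Q x y = G)
    (hy : Q y = G * algebraMap O K β) (hspan' : Submodule.span O {z} = L₁) :
    ¬ IsUniversal Q L := by
  intro hun
  have h2 := dvd_two he he1
  have hlt : scale Q L₂ < scale Q L₁ := hJ.scale_lt 0 1 (by decide)
  rw [← hspan, ← hspan', scale_span_pair hx hxy hy, scale_span_singleton] at hlt
  obtain ⟨m, hm, hGm⟩ := span_singleton_lt hlt
  have hxm : x ∈ L₂ := hspan ▸ Submodule.subset_span (.inl rfl)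
  have hym : y ∈ L₂ := hspan ▸ Submodule.subset_span (.inr rfl)
  have hzm : z ∈ L₁ := hspan' ▸ Submodule.mem_span_singleton_self z
  have horth : Orth Q L₂ L₁ := hJ.orth 1 0 (by decide)
  have hspanL : Submodule.span O {x, y, z} = L := by
    rw [← hJ.sup_eq, ← hspan, ← hspan', ← Submodule.span_union]
    congr 1
    ext v; simp
  obtain ⟨D, hD⟩ : ∃ D, Q z = algebraMap O K D := by
    have : Q z ∈ {c : K | ∃ x ∈ L, Q x = c} :=
      ⟨z, hJ.sup_eq ▸ Submodule.mem_sup_left hzm, rfl⟩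
    rw [hun] at this
    obtain ⟨D, hD⟩ := this
    exact ⟨D, hD.symm⟩
  rw [hD] at hGm
  have hf : IsFrame Q L x y z (D * m * α) (2 * (D * m)) (D * m * β) D :=
    ⟨hspanL, by rw [hx, hGm]; simp, by rw [hy, hGm]; simp, hD, by rw [hxy, hGm]; simp only [map_mul, map_ofNat],
      horth x hxm z hzm, horth y hym z hzm⟩
  have huniv := hf.isUniversal_iff.1 hun
  rw [isUnit_iff_not_dvd hπ, not_not] at hm
  obtain ⟨m, rfl⟩ := hm
  -- All coefficients are multiples of `D`, and `1` is represented.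
  have hDu : IsUnit D := by
    obtain ⟨x, y, z, hxyz⟩ := huniv 1
    unfold ternary at hxyz
    refine .of_mul_eq_one (π * m * α * x ^ 2 + 2 * (π * m) * x * y + π * m * β * y ^ 2 + z ^ 2) ?_
    linear_combination hxyz
  obtain ⟨d, hd⟩ := h2
  -- Otherwise, `D` being a unit, every represented multiple of `π` would be a multiple of `π²`, and
  -- `π` would be missed.
  have hmαβ : ¬ (π ∣ m * α ∧ π ∣ m * β) := by
    rintro ⟨⟨a, ha⟩, ⟨b, hb⟩⟩
    obtain ⟨x, y, z, hxyz⟩ := huniv π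
    unfold ternary at hxyz
    obtain ⟨z, rfl⟩ : π ∣ z := (dvd_sq_iff hπ hDu).1 ⟨1 - (D * m * α) * x ^ 2 -
      2 * (D * m) * x * y - (D * m * β) * y ^ 2, by linear_combination hxyz⟩
    refine hπ.not_isUnit (.of_mul_eq_one (D * a * x ^ 2 + d * (D * m) * x * y + D * b * y ^ 2 +
      D * z ^ 2) (mul_left_cancel₀ hπ.ne_zero ?_))
    linear_combination hxyz - π * D * x ^ 2 * ha - π * D * y ^ 2 * hb - π * D * m * x * y * hd
  have hmu : IsUnit m := by
    rw [isUnit_iff_not_dvd hπ]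
    exact fun hm => hmαβ ⟨hm.mul_right _, hm.mul_right _⟩
  have aux : ∀ {x y : V} {α β : O}, IsUnit (1 - α * β) → IsUnit α →
      IsFrame Q L x y z (D * (π * m) * α) (2 * (D * (π * m))) (D * (π * m) * β) D → False := by
    intro x y α β hu hα hf
    rw [show D * (π * m) * α = π * (D * m * α) by ring,
      show 2 * (D * (π * m)) = 2 * π * (D * m) by ring,
      show D * (π * m) * β = π * (D * m * β) by ring] at hf
    have huniv := hf.isUniversal_iff.1 hun
    obtain ⟨a, b, c, habc⟩ := huniv (-(4 * (π * (D * m * α)) * (π * (D * m * β)) -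
      (2 * π * (D * m)) ^ 2) * D)
    have hbu : IsUnit (D * m * α) := (hDu.mul hmu).mul hα
    obtain ⟨a, b, c, h0, hiso⟩ := exists_isotropic (mul_ne_zero hπ.ne_zero hbu.ne_zero) habc
    obtain ⟨t, ht⟩ := exists_not_represented_of_unit hπ he hε he1 hDu hbu
      (c := D * m * β) (l := D * m) (by
        rw [show D * m * α * (D * m * β) - (D * m) ^ 2 = -((D * m) ^ 2 * (1 - α * β)) by ring]
        exact (((hDu.mul hmu).pow 2).mul hu).neg) h0 hiso
    obtain ⟨a, b, c, habc⟩ := huniv t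
    exact ht a b c habc
  by_cases hα : IsUnit α
  · exact aux hu hα hf
  · refine aux (by rwa [mul_comm]) ?_ hf.swap
    rw [isUnit_iff_not_dvd hπ] at hα ⊢
    intro hβ
    rw [not_not] at hα
    exact hmαβ ⟨hα.mul_left _, hβ.mul_left _⟩

/-- The relation of norms makes `E` a nonunit, so `n(L) = O` forces `n(L₁) = O` and `E` is a prime.
-/
theorem IsBinaryFrame.represents_of_prime (hπ : Irreducible π) (he : (2 : O) = π ^ e * ε)
    (hε : IsUnit ε) (he1 : 1 ≤ e) (hf : IsBinaryFrame Q L L₁ L₂ e₁ e₂ e₃ A H C E h)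
    (hL : L.IsLattice K) (hn : norm Q L = 1) (hiso : ¬ Q.Anisotropic)
    (hI : IsLocalRing.maximalIdeal O * Ideal.span {A, H, C} = Ideal.span {E}) (t : O) :
    ∃ x y z, ternary A H C E x y z = t := by
  rw [hπ.maximalIdeal_eq] at hI
  have hE : π ∣ E := by
    have hmem := Ideal.mem_span_singleton_self E
    rw [← hI] at hmem
    exact Ideal.mem_span_singleton.1 (Ideal.mul_le_left hmem)
  have hEu : ¬ IsUnit E := by rwa [isUnit_iff_not_dvd hπ, not_not]
  have hAHC : IsUnit A ∨ IsUnit H ∨ IsUnit C := by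
    have := hf.exists_isUnit hn
    tauto
  have htop : Ideal.span {A, H, C} = ⊤ := by
    rcases hAHC with h | h | h <;>
      exact Ideal.eq_top_of_isUnit_mem _ (Ideal.subset_span (by simp)) h
  rw [htop, Ideal.mul_top, Ideal.span_singleton_eq_span_singleton] at hI
  obtain ⟨b, rfl⟩ := hI
  obtain ⟨x, y, z, h0, hiso⟩ := hf.exists_isotropic hL hiso
  rcases (by tauto : (IsUnit A ∨ IsUnit H) ∨ IsUnit C) with hu | hu
  · exact represents_of_isotropic_of_prime hπ he hε he1 hu b.isUnit hf.mul_eq_two hf.modular h0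
      hiso t
  · rw [ternary_swap] at hiso
    obtain ⟨x, y, z, hxyz⟩ := represents_of_isotropic_of_prime hπ he hε he1 (.inl hu) b.isUnit
      hf.mul_eq_two hf.swap.modular (fun hh => h0 ⟨hh.2.1, hh.1, hh.2.2⟩) hiso t
    exact ⟨y, x, z, by rw [ternary_swap, hxyz]⟩

/-- The relation of norms puts `A`, `H`, `C` into `(π)`, so `n(L) = O` forces `E` to be a unit and
`n(L₁) = (π)`. Since `h E` is not a unit, `π ∣ h`. -/
theorem IsBinaryFrame.represents_of_unit (hπ : Irreducible π) (he : (2 : O) = π ^ e * ε)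
    (hε : IsUnit ε) (hf : IsBinaryFrame Q L L₁ L₂ e₁ e₂ e₃ A H C E h)
    (hL : L.IsLattice K) (hn : norm Q L = 1) (hiso : ¬ Q.Anisotropic)
    (hI : Ideal.span {A, H, C} = IsLocalRing.maximalIdeal O * Ideal.span {E}) (t : O) :
    ∃ x y z, ternary A H C E x y z = t := by
  rw [hπ.maximalIdeal_eq] at hI
  have hle : Ideal.span {A, H, C} ≤ Ideal.span {π} := hI.trans_le Ideal.mul_le_left
  have hm : ∀ a ∈ ({A, H, C} : Set O), π ∣ a := fun a ha =>
    Ideal.mem_span_singleton.1 (hle (Ideal.subset_span ha))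
  obtain ⟨a, rfl⟩ := hm A (by simp)
  obtain ⟨b, rfl⟩ := hm H (by simp)
  obtain ⟨c, rfl⟩ := hm C (by simp)
  have hnu : ∀ a, ¬ IsUnit (π * a) := fun a => by
    rw [isUnit_iff_not_dvd hπ, not_not]; exact dvd_mul_right _ _
  have hE : IsUnit E := by
    have h1 := hf.exists_isUnit hn
    have h2 := hnu a
    have h3 := hnu b
    have h4 := hnu c
    tauto
  have hh : π ∣ h := by
    by_contra hh
    exact hf.not_isUnit (((isUnit_iff_not_dvd hπ).2 hh).mul hE)
  rw [Ideal.span_singleton_eq_top.2 hE, Ideal.mul_top] at hI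
  have habc : IsUnit a ∨ IsUnit b ∨ IsUnit c := by
    by_contra hcon
    simp only [not_or, isUnit_iff_not_dvd hπ, not_not] at hcon
    have h1 : π ∈ Ideal.span {π * π} := by
      have : Ideal.span {π * a, π * b, π * c} ≤ Ideal.span {π * π} := by
        rw [Ideal.span_le]
        simp only [Set.insert_subset_iff, Set.singleton_subset_iff, SetLike.mem_coe,
          Ideal.mem_span_singleton]
        exact ⟨mul_dvd_mul_left _ hcon.1, mul_dvd_mul_left _ hcon.2.1,
          mul_dvd_mul_left _ hcon.2.2⟩
      exact this (hI ▸ Ideal.mem_span_singleton_self π)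
    obtain ⟨k, hk⟩ := Ideal.mem_span_singleton.1 h1
    exact hπ.not_isUnit (.of_mul_eq_one k (mul_left_cancel₀ hπ.ne_zero (by
      linear_combination -hk)))
  obtain ⟨x, y, z, h0, hiso⟩ := hf.exists_isotropic hL hiso
  rcases (by tauto : (IsUnit a ∨ IsUnit b) ∨ IsUnit c) with hu | hu
  · exact represents_of_isotropic_of_unit hπ he hε hE hf.mul_eq_two hh hu h0 hiso t
  · rw [ternary_swap] at hiso
    obtain ⟨x, y, z, hxyz⟩ := represents_of_isotropic_of_unit hπ he hε hE hf.mul_eq_two hh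
      (.inl hu) (fun hh => h0 ⟨hh.2.1, hh.1, hh.2.2⟩) hiso t
    exact ⟨y, x, z, by rw [ternary_swap, hxyz]⟩

/-- A universal lattice with a binary first Jordan component satisfies one of the three
conditions. -/
theorem IsBinaryFrame.cases_of_represents [HenselianLocalRing O] (hπ : Irreducible π)
    (he : (2 : O) = π ^ e * ε) (hε : IsUnit ε) (he1 : 1 ≤ e)
    (hV : Module.finrank K V = 3) (hQ : Q.polarBilin.Nondegenerate) (hL : L.IsLattice K)
    (hJ : IsMinimalNormJordanSplitting Q L ![L₁, L₂])
    (hf : IsBinaryFrame Q L L₁ L₂ e₁ e₂ e₃ A H C E h) (hn : norm Q L = 1)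
    (hu : ∀ t, ∃ x y z, ternary A H C E x y z = t) :
    IsBinary Q 2⁻¹ 0 0 L₁ ∨
      (IsLocalRing.maximalIdeal O * Ideal.span {A, H, C} = Ideal.span {E} ∧ ¬ Q.Anisotropic) ∨
      (Ideal.span {A, H, C} = IsLocalRing.maximalIdeal O * Ideal.span {E} ∧
        ¬ Q.Anisotropic) := by
  have h2 := dvd_two he he1
  obtain ⟨x, y, z, h0, hiso⟩ : ∃ x y z : O, ¬ (x = 0 ∧ y = 0 ∧ z = 0) ∧
      ternary A H C E x y z = 0 := by
    by_cases hA : A = 0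
    · exact ⟨1, 0, 0, by simp, by simp [ternary, hA]⟩
    · obtain ⟨x, y, z, hxyz⟩ := hu (-(4 * A * C - H ^ 2) * E)
      exact QuadLattice.exists_isotropic hA hxyz
  have han := hf.not_anisotropic hV hL h0 hiso
  rw [hπ.maximalIdeal_eq]
  by_cases hAHC : IsUnit A ∨ IsUnit H ∨ IsUnit C
  · have htop : Ideal.span {A, H, C} = ⊤ := by
      rcases hAHC with h | h | h <;>
        exact Ideal.eq_top_of_isUnit_mem _ (Ideal.subset_span (by simp)) h
    by_cases hE : IsUnit E
    · left
      obtain ⟨x, y, z, hp, hiso⟩ := exists_primitive hπ h0 hiso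
      by_cases hH : IsUnit H
      · refine hf.isBinary_of_minimal hV hQ hL hπ h2 hJ hH (x := x) (y := y) ?_ hiso
        rintro ⟨⟨x, rfl⟩, ⟨y, rfl⟩⟩
        refine hp ⟨dvd_mul_right _ _, dvd_mul_right _ _, (dvd_sq_iff hπ hE).1
          ⟨-(A * π * x ^ 2 + H * π * x * y + C * π * y ^ 2), ?_⟩⟩
        unfold ternary at hiso
        linear_combination hiso
      · have hH' : π ∣ H := by rwa [isUnit_iff_not_dvd hπ, not_not] at hH
        exact absurd hAHC (by
          have h1 := hf.not_isUnit_fst hV hQ hL hπ h2 hJ hH' hE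
          have h3 := hf.swap.not_isUnit_fst hV hQ hL hπ h2 hJ hH' hE
          tauto)
    rw [isUnit_iff_not_dvd hπ, not_not] at hE
    obtain ⟨b, rfl⟩ := hE
    by_cases hb : IsUnit b
    · right; left
      refine ⟨?_, han⟩
      rw [htop, Ideal.mul_top, Ideal.span_singleton_eq_span_singleton]
      exact ⟨hb.unit, rfl⟩
    left
    rw [isUnit_iff_not_dvd hπ, not_not] at hb
    have hE2 : π ^ 2 ∣ π * b := by rw [sq]; exact mul_dvd_mul_left _ hb
    -- For unit `H`, representing `π` although `π² ∣ E` yields a primitive zero of the binary part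
    -- modulo `π`, which Hensel's lemma lifts.
    by_cases hH : IsUnit H
    · obtain ⟨x, y, z, hxyz⟩ := hu π
      obtain ⟨E', hE'⟩ := hE2
      unfold ternary at hxyz
      obtain ⟨x, y, hxy, hiso⟩ := exists_binary_isotropic hπ h2 (A := A) (C := C) (x := x) (y := y)
        hH (by
          rintro ⟨⟨x, rfl⟩, ⟨y, rfl⟩⟩
          refine hπ.not_isUnit (.of_mul_eq_one (A * x ^ 2 + H * x * y + C * y ^ 2 + E' * z ^ 2)
            (mul_left_cancel₀ hπ.ne_zero ?_))
          linear_combination hxyz - z ^ 2 * hE')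
        ⟨1 - b * z ^ 2, by linear_combination hxyz⟩
      exact hf.isBinary_of_primitive hπ h2 hH hxy hiso
    · exfalso
      have hH' : π ∣ H := by rwa [isUnit_iff_not_dvd hπ, not_not] at hH
      rcases (by tauto : IsUnit A ∨ IsUnit C) with hA | hC
      · obtain ⟨t, ht⟩ := exists_not_represented_of_sq_dvd hπ he hε he1 hA hf.mul_eq_two hH'
          hf.modular hE2 hf.ne_zero h0 hiso
        obtain ⟨x, y, z, hxyz⟩ := hu t
        exact ht x y z hxyz
      · rw [ternary_swap] at hiso
        obtain ⟨t, ht⟩ := exists_not_represented_of_sq_dvd hπ he hε he1 hC hf.mul_eq_two hH'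
          hf.swap.modular hE2 hf.ne_zero (fun hh => h0 ⟨hh.2.1, hh.1, hh.2.2⟩) hiso
        obtain ⟨x, y, z, hxyz⟩ := hu t
        exact ht y x z (by rw [← ternary_swap, hxyz])
  · right; right
    refine ⟨?_, han⟩
    have hE : IsUnit E := by
      have := hf.exists_isUnit hn
      tauto
    rw [Ideal.span_singleton_eq_top.2 hE, Ideal.mul_top]
    simp only [not_or, isUnit_iff_not_dvd hπ, not_not] at hAHC
    obtain ⟨⟨a, rfl⟩, ⟨b, rfl⟩, ⟨c, rfl⟩⟩ := hAHC
    apply le_antisymm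
    · rw [Ideal.span_le]
      simp only [Set.insert_subset_iff, Set.singleton_subset_iff, SetLike.mem_coe,
        Ideal.mem_span_singleton]
      exact ⟨dvd_mul_right _ _, dvd_mul_right _ _, dvd_mul_right _ _⟩
    · rw [Ideal.span_singleton_le_iff_mem]
      -- In a representation of `π` the coordinate `z` is divisible by `π`, so the binary part takes
      -- the value `π` times the unit `1 - π E z²` (new `z`).
      obtain ⟨x, y, z, hxyz⟩ := hu π
      unfold ternary at hxyz
      obtain ⟨z, rfl⟩ : π ∣ z := (dvd_sq_iff hπ hE).1
        ⟨1 - a * x ^ 2 - b * x * y - c * y ^ 2, by linear_combination hxyz⟩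
      have hu' : IsUnit (1 + π * (-(E * z ^ 2))) :=
        isUnit_add_of_dvd hπ isUnit_one (dvd_mul_right _ _)
      obtain ⟨w, hw⟩ := hu'.exists_left_inv
      have hmem : w * ((π * a) * x ^ 2 + (π * b) * (x * y) + (π * c) * y ^ 2) ∈
          Ideal.span {π * a, π * b, π * c} := by
        refine Ideal.mul_mem_left _ _ (add_mem (add_mem ?_ ?_) ?_) <;>
          exact Ideal.mul_mem_right _ _ (Ideal.subset_span (by simp))
      convert hmem using 1
      linear_combination (-π) * hw - w * hxyz

theorem isUniversal_of_isBinary (hle : L₁ ≤ L) (hn : norm Q L = 1)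
    (hb : IsBinary Q (2⁻¹ : K) 0 0 L₁) : IsUniversal Q L := by
  ext c
  constructor
  · rintro ⟨w, hw, rfl⟩
    obtain ⟨t, ht⟩ := exists_map_eq_of_norm_eq_one hn hw
    exact ⟨t, ht.symm⟩
  · rintro ⟨t, rfl⟩
    obtain ⟨x, y, -, hxy, hx, hb, hy⟩ := hb
    refine ⟨x + t • y, hle (hxy ▸ Submodule.mem_span_pair.2 ⟨1, t, by rw [one_smul]⟩), ?_⟩
    rw [map_add_eq, map_smul_sq, bil_smul_right, hx, hb, hy]
    field_simp; ring

theorem isUniversal_iff [HenselianLocalRing O] (h2 : ¬ IsUnit (2 : O))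
    (hV : Module.finrank K V = 3) (hQ : Q.polarBilin.Nondegenerate) (hL : L.IsLattice K)
    (hJ : IsMinimalNormJordanSplitting Q L ![L₁, L₂]) :
    IsUniversal Q L ↔
      norm Q L = 1 ∧ Module.finrank O L₁ = 2 ∧
        (IsBinary Q 2⁻¹ 0 0 L₁ ∨
          (IsLocalRing.maximalIdeal O • norm Q L₁ = norm Q L₂ ∧ ¬ Q.Anisotropic) ∨
          (norm Q L₁ = IsLocalRing.maximalIdeal O • norm Q L₂ ∧ ¬ Q.Anisotropic)) := by
  obtain ⟨π, hπ⟩ := IsDiscreteValuationRing.exists_irreducible O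
  obtain ⟨e, ε, hε, he⟩ := exists_eq_pow_mul hπ (two_ne_zero (α := O))
  have he1 : 1 ≤ e := by
    rcases Nat.eq_zero_or_pos e with rfl | h
    · exact absurd (by rwa [he, pow_zero, one_mul]) h2
    · exact h
  have hun : IsUniversal Q L → norm Q L = 1 := by
    intro h
    unfold norm
    rw [h, Submodule.one_eq_range]
    exact Submodule.span_eq (LinearMap.range (Algebra.linearMap O K))
  have hle : L₁ ≤ L := hJ.sup_eq ▸ le_sup_left
  rcases hJ.toIsJordanSplitting.cases hV hL with
    ⟨hr, x, y, z, G, α, β, hG, hu, hs, hx, hxy, hy, hs', hz⟩ |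
    ⟨hr, x, y, z, G, α, β, hG, hu, hs, hx, hxy, hy, hs', hz⟩
  · have key : norm Q L = 1 → ∃ A H C E h, IsBinaryFrame Q L L₁ L₂ x y z A H C E h :=
      fun hn => exists_isBinaryFrame hJ.toIsJordanSplitting hn hG hu hs hx hxy hy hs' hz
    have hnorm : ∀ {A H C E h}, IsBinaryFrame Q L L₁ L₂ x y z A H C E h →
        norm Q L₁ = Submodule.map (Algebra.linearMap O K) (Ideal.span {A, H, C}) ∧
        norm Q L₂ = Submodule.map (Algebra.linearMap O K) (Ideal.span {E}) := by
      intro A H C E h hf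
      rw [← hf.span_pair, ← hf.span_trd]
      exact ⟨norm_span_pair hf.map_fst hf.two_mul_bil hf.map_snd,
        norm_span_singleton hf.map_trd⟩
    constructor
    · intro h
      have hn := hun h
      obtain ⟨A, H, C, E, h', hf⟩ := key hn
      refine ⟨hn, hr, ?_⟩
      rw [(hnorm hf).1, (hnorm hf).2, maximalIdeal_smul_eq_iff, eq_comm (b := _ • _),
        maximalIdeal_smul_eq_iff, eq_comm (b := Ideal.span {A, H, C})]
      exact hf.cases_of_represents hπ he hε he1 hV hQ hL hJ hn (hf.isUniversal_iff.1 h)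
    · rintro ⟨hn, -, hc⟩
      obtain ⟨A, H, C, E, h', hf⟩ := key hn
      rw [(hnorm hf).1, (hnorm hf).2, maximalIdeal_smul_eq_iff, eq_comm (b := _ • _),
        maximalIdeal_smul_eq_iff, eq_comm (b := Ideal.span {A, H, C})] at hc
      rcases hc with hb | ⟨hI, hiso⟩ | ⟨hI, hiso⟩
      · exact isUniversal_of_isBinary hle hn hb
      · exact hf.isUniversal_iff.2 (hf.represents_of_prime hπ he hε he1 hL hn hiso hI)
      · exact hf.isUniversal_iff.2 (hf.represents_of_unit hπ he hε hL hn hiso hI)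
  · constructor
    · intro h
      exact absurd h (not_isUniversal_of_finrank_eq_one hπ he hε he1 hJ.toIsJordanSplitting hu hs
        hx hxy hy hs')
    · rintro ⟨-, h, -⟩
      omega

end Universal

/-- The ring of integers of a local field is Henselian. -/
theorem henselianLocalRing_integer (K : Type*) [Field K] [ValuativeRel K] [TopologicalSpace K]
    [IsNonarchimedeanLocalField K] : HenselianLocalRing 𝒪[K] := by
  let := IsTopologicalAddGroup.rightUniformSpace K
  have := isUniformAddGroup_of_addCommGroup (G := K)
  have : HenselianRing 𝒪[K] (IsLocalRing.maximalIdeal 𝒪[K]) := inferInstance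
  exact ⟨fun f hf a h1 h2 => HenselianRing.is_henselian f hf a h1 (h2.map _)⟩

end QuadLattice

theorem proposition2p13
    {K : Type*} [Field K] [CharZero K] [ValuativeRel K] [TopologicalSpace K]
    [IsNonarchimedeanLocalField K] (h2 : ValuativeRel.valuation K 2 < 1)
    {V : Type*} [AddCommGroup V] [Module K V] (hV : Module.finrank K V = 3)
    (Q : QuadraticForm K V) (hQ : Q.polarBilin.Nondegenerate)
    (L : Submodule 𝒪[K] V) (hL : L.IsLattice K)
    (L₁ L₂ : Submodule 𝒪[K] V)
    (hJ : QuadLattice.IsMinimalNormJordanSplitting Q L ![L₁, L₂]) :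
    QuadLattice.IsUniversal Q L ↔
      QuadLattice.norm Q L = 1 ∧ Module.finrank 𝒪[K] L₁ = 2 ∧
        (QuadLattice.IsBinary Q 2⁻¹ 0 0 L₁ ∨
          (𝓂[K] • QuadLattice.norm Q L₁ = QuadLattice.norm Q L₂ ∧ ¬ Q.Anisotropic) ∨
          (QuadLattice.norm Q L₁ = 𝓂[K] • QuadLattice.norm Q L₂ ∧ ¬ Q.Anisotropic)) := by
  have := QuadLattice.henselianLocalRing_integer K
  refine QuadLattice.isUniversal_iff ?_ hV hQ hL hJ
  intro hu
  have h := (Valuation.integer.integers (ValuativeRel.valuation K)).one_of_isUnit hu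
  rw [map_ofNat] at h
  exact h2.ne h
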